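/- **Notation.** Quaternions are $\mathbb R^4=\mathbb R\times\mathbb R^3$ with the Hamilton product $\circ$ and conjugation $*$; $\operatorname{aug}(x)=(0,x)$ for $x\in\mathbb R^3$, and $\operatorname{red}$ takes the vector part. Dual numbers are $a+\epsilon b$ with $\epsilon^2=0$; products, cross products, conjugation, $\operatorname{aug}$ and $\operatorname{red}$ are extended to dual quaternions and dual vectors $\mathring x=x_r+\epsilon x_c$ ($x_r,x_c\in\mathbb R^3$) accordingly. Let $\operatorname{crs}(\mathring x,\mathring y)=x_r^\top y_c+x_c^\top y_r$, $\operatorname{exch}(\mathring x)=x_c+\epsilon x_r$, $\operatorname{real}(\mathring x)=x_r$, $\operatorname{comp}(\mathring x)=x_c$, let $\operatorname{sgn}$ act componentwise with $\operatorname{sgn}(0)=0$, and $$\operatorname{func}(\mathring x,\mathring y,\mathring z)=(\|y_r\times y_c+z_c\|_2+1)\operatorname{sgn}(x_c)+\epsilon(\|y_r\|_2^2+\|z_r\|_2+1)\operatorname{sgn}(x_r).$$ **Plant.** Let $m>0$, let $J\in\mathbb R^{3\times3}$ be symmetric positive definite, $\mathring M(x_r+\epsilon x_c)=m x_c+\epsilon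 Jx_r$, and $0=h_0<h_1<\dots<h_s=T$, $s\ge1$. The desired pose is $\mathring Q_d=Q_d+\epsilon\frac12Q_d\circ\operatorname{aug}(P_d)$ with $Q_d(t)$ a unit quaternion and $P_d(t)\in\mathbb R^3$; it satisfies $\dot{\mathring Q}_d=\frac12\mathring Q_d\circ\operatorname{aug}(\mathring\omega_d)$ on $[0,T]$, where $\mathring\omega_d$ is differentiable and $\mathring\omega_d,\dot{\mathring\omega}_d$ are bounded on $[0,T]$. In iteration $k=0,1,2,\dots$ the body has pose $\mathring Q_k=Q_k+\epsilon\frac12Q_k\circ\operatorname{aug}(P_k)$, with $Q_k(t)$ a unit quaternion, and dual velocity $\mathring\omega_k$, with $$\dot{\mathring Q}_k=\tfrac12\mathring Q_k\circ\operatorname{aug}(\mathring\omega_k),\qquad \mathring M\dot{\mathring\omega}_k=-\mathring\omega_k\times\mathring M\mathring\omega_k+\mathring f_k+\mathring d_k\qquad\text{on }[0,T],$$ where $\mathring f_k$ is the control input and $\mathring d_k=d_k+\epsilon s_k$ the disturbance, $\|d_k(t)\|\le\beta_d(t)$, $\|s_k(t)\|\le\beta_s(t)$ for all $k$ and $t\in[0,T]$,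 with $\beta_d,\beta_s$ bounded on $[0,T]$. Put $\delta\mathring Q_k=\mathring Q_d^*\circ\mathring Q_k$, with real part $\delta Q_k=Q_d^*\circ Q_k$, and $\delta q_k=\operatorname{red}(\delta Q_k)$, $\delta P_k=P_k-\operatorname{red}(\delta Q_k^*\circ\operatorname{aug}(P_d)\circ\delta Q_k)$, $\operatorname{tr}(\mathring x)=\operatorname{red}(\delta\mathring Q_k^*\circ\operatorname{aug}(\mathring x)\circ\delta\mathring Q_k)$, $\delta\mathring\omega_k=\mathring\omega_k-\operatorname{tr}(\mathring\omega_d)$. Assume that for every $k$ there is a sign $\varsigma_k\in\{1,-1\}$ with $\delta\mathring Q_k(0)=\varsigma_k\mathbf 1+\epsilon\mathbf 0$, where $\mathbf 1=(1,0,0,0)$, and that $\delta\mathring\omega_k(0)=0$. **Control.** Let $k_p,k_d,k_c,k_\theta,k_l>0$. The control input is $$\mathring f_k=-\hat\theta_k\operatorname{func}(\delta\mathring\omega_k,\operatorname{tr}(\mathring\omega_d),\operatorname{tr}(\dot{\mathring\omega}_d))-k_d\operatorname{exch}(\delta\mathring\omega_k)-\epsilon k_p\operatorname{red}(\operatorname{real}(\delta\mathring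 Q_k))-k_p\operatorname{red}(\operatorname{real}(\delta\mathring Q_k^*)\circ\operatorname{comp}(\delta\mathring Q_k)).$$ For $t\in[0,T]$ let $p(t)=\min\{j\in\{1,\dots,s\}:h_j\ge t\}$, and for $x:[0,T]\to\mathbb R$ let $\operatorname{proj}(x(t))=\max\{x(t),\ \sup_{\tau\in(h_{p(t)-1},h_{p(t)}]}x(\tau)-k_c\}$. The estimates satisfy $\hat\theta_0=0$ and, for $k\ge1$ and $t\in[0,T]$, $$\hat\theta_k(t)-\operatorname{proj}(\hat\theta_{k-1}(t))=\min\Big\{k_l,\ k_\theta\operatorname{crs}\big(\delta\mathring\omega_k(t),\operatorname{func}(\delta\mathring\omega_k(t),\operatorname{tr}(\mathring\omega_d(t)),\operatorname{tr}(\dot{\mathring\omega}_d(t)))\big)\Big\}.$$ Since $\operatorname{sgn}$ is discontinuous, solutions are understood in the sense of Filippov: $\mathring\omega_k$ is absolutely continuous, the dynamics hold for almost every $t$, and in $\mathring f_k$ the sign of a vanishing component of $\delta\mathring\omega_k(t)$ may take any value in $[-1,1]$; solutions with $\operatorname{sgn}(0)=0$ are a special case. **Theorem.** For every such sequence of closed-loop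 solutions on $[0,T]$: 1. (perfect position-attitude tracking) for every $t\in[0,T]$, $\lim_{k\to\infty}\|\delta P_k(t)\|_2=0$, $\lim_{k\to\infty}\|\delta q_k(t)\|_2=0$, and $\lim_{k\to\infty}\varsigma_k\mathring Q_k(t)=\mathring Q_d(t)$; in particular $\mathring Q_k(t)\to\mathring Q_d(t)$ if all $\varsigma_k=1$; 2. (boundedness) the real and dual parts of $\mathring f_k(t)$, $\delta\mathring Q_k(t)$ and $\delta\mathring\omega_k(t)$, and the estimates $\hat\theta_k(t)$, are bounded uniformly in $k\ge0$ and $t\in[0,T]$. -/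

import Mathlib

open scoped Quaternion

noncomputable section

namespace DualILC

/-- Euclidean three-space. -/
abbrev E3 := EuclideanSpace ℝ (Fin 3)

/-- Dual vectors `x_r + ε x_c` in dimension three: `x.1 = x_r` is the real part and `x.2 = x_c` the
dual part. -/
abbrev DualVec := E3 × E3

/-- Dual quaternions `Q_r + ε Q_c`: dual numbers over Hamilton's quaternions, so that the product is
`Q_r Q_r' + ε (Q_r Q_c' + Q_c Q_r')`. -/
abbrev DualQuat := DualNumber ℍ[ℝ]

/-- Dual quaternion from its real and dual parts. -/
def mkDQ (a b : ℍ[ℝ]) : DualQuat := TrivSqZeroExt.inl a + TrivSqZeroExt.inr b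

/-- The real part of a dual quaternion. -/
def re (Q : DualQuat) : ℍ[ℝ] := TrivSqZeroExt.fst Q

/-- The dual part of a dual quaternion. -/
def du (Q : DualQuat) : ℍ[ℝ] := TrivSqZeroExt.snd Q

/-- Conjugation `Q* = Q_r* + ε Q_c*`. -/
def conj (Q : DualQuat) : DualQuat := mkDQ (star (re Q)) (star (du Q))

/-- A vector of `ℝ³` as a quaternion with zero scalar part. -/
def aug (x : E3) : ℍ[ℝ] := ⟨0, x 0, x 1, x 2⟩

/-- The vector part of a quaternion. -/
def red (Q : ℍ[ℝ]) : E3 := !₂[Q.imI, Q.imJ, Q.imK]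

def dualAug (x : DualVec) : DualQuat := mkDQ (aug x.1) (aug x.2)

def dualRed (Q : DualQuat) : DualVec := (red (re Q), red (du Q))

/-- The cross product on Euclidean three-space. -/
def cross (x y : E3) : E3 := WithLp.toLp 2 (crossProduct x.ofLp y.ofLp)

/-- The cross product of dual vectors. -/
def dualCross (x y : DualVec) : DualVec := (cross x.1 y.1, cross x.1 y.2 + cross x.2 y.1)

/-- `crs(x, y) = x_rᵀ y_c + x_cᵀ y_r`. -/
def crs (x y : DualVec) : ℝ := inner ℝ x.1 y.2 + inner ℝ x.2 y.1

/-- `exch(x_r + ε x_c) = x_c + ε x_r`. -/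
def exch (x : DualVec) : DualVec := (x.2, x.1)

/-- The dual inertia operator `m I₃ d/dε + ε J`, i.e. `x_r + ε x_c ↦ m x_c + ε J x_r`. -/
def inertia (m : ℝ) (J : Matrix (Fin 3) (Fin 3) ℝ) (x : DualVec) : DualVec :=
  (m • x.2, WithLp.toLp 2 (J.mulVec x.1.ofLp))

/-- The unit dual quaternion `Q + ε ½ Q ∘ aug(P)` of the pose with attitude `Q` and position `P`. -/
def pose (Q : ℍ[ℝ]) (P : E3) : DualQuat := mkDQ Q ((1 / 2 : ℝ) • (Q * aug P))

/-- The dual quaternion error `Q_d* ∘ Q`. -/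
def poseErr (Qd Q : DualQuat) : DualQuat := conj Qd * Q

/-- The position error `P - red(δQ* ∘ aug(P_d) ∘ δQ)`, where `δQ = Q_d* ∘ Q`. -/
def posErr (Qd : ℍ[ℝ]) (Pd : E3) (Q : ℍ[ℝ]) (P : E3) : E3 :=
  P - red (star (star Qd * Q) * aug Pd * (star Qd * Q))

/-- The vector part of the attitude error `Q_d* ∘ Q`. -/
def attErr (Qd Q : ℍ[ℝ]) : E3 := red (star Qd * Q)

/-- `tr(x) = red(δQ* ∘ aug(x) ∘ δQ)`. -/
def tr (δQ : DualQuat) (x : DualVec) : DualVec := dualRed (conj δQ * dualAug x * δQ)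

/-- The dual velocity error `ω - tr(ω_d)`. -/
def velErr (δQ : DualQuat) (ωd ω : DualVec) : DualVec := ω - tr δQ ωd

/-- The componentwise sign, with `sgn 0 = 0`. -/
def sgn (x : E3) : E3 := WithLp.toLp 2 (fun i => Real.sign (x i))

def dualSgn (x : DualVec) : DualVec := (sgn x.1, sgn x.2)

/-- The set-valued sign: `{sgn x}` for `x ≠ 0`, and `[-1, 1]` at `x = 0`. -/
def SgnSet (x : ℝ) : Set ℝ := if x = 0 then Set.Icc (-1) 1 else {Real.sign x}

/-- `σ` is a componentwise selection of the set-valued sign of `x`. -/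
def IsSgnSelection (σ x : DualVec) : Prop :=
  (∀ i, σ.1 i ∈ SgnSet (x.1 i)) ∧ (∀ i, σ.2 i ∈ SgnSet (x.2 i))

/-- The single-valued sign (with `sgn 0 = 0`) is such a selection. -/
theorem isSgnSelection_dualSgn (x : DualVec) : IsSgnSelection (dualSgn x) x := by
  have h : ∀ r : ℝ, Real.sign r ∈ SgnSet r := by
    intro r
    by_cases hr : r = 0
    · simp [SgnSet, hr]
    · simp [SgnSet, hr]
  exact ⟨fun i => h _, fun i => h _⟩

/-- `(‖y_r × y_c + z_c‖ + 1) σ_c + ε (‖y_r‖² + ‖z_r‖ + 1) σ_r`, where `σ` stands for the sign of the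
first argument of `func`. -/
def funcOfSgn (σ y z : DualVec) : DualVec :=
  ((‖cross y.1 y.2 + z.2‖ + 1) • σ.2, (‖y.1‖ ^ 2 + ‖z.1‖ + 1) • σ.1)

/-- `func(x, y, z)`. -/
def func (x y z : DualVec) : DualVec := funcOfSgn (dualSgn x) y z

/-- The control law
`-θ̂ func(δω, tr ω_d, tr ω_d') - k_d exch(δω) - ε k_p red(real δQ) - k_p red(real(δQ*) ∘ comp(δQ))`,
where `σ` is the value used for `sgn(δω)` in `func`. -/
def control (kp kd θ : ℝ) (σ : DualVec) (δQ : DualQuat) (δω ωd ωd' : DualVec) : DualVec :=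
  -(θ • funcOfSgn σ (tr δQ ωd) (tr δQ ωd')) - kd • exch δω
    - (0, kp • red (re δQ)) - (kp • red (re (conj δQ) * du δQ), 0)

/-- The index `p(t) = min {j ∈ {1, …, s} : h_j ≥ t}` of the segment containing `t`. -/
def segIndex (s : ℕ) (h : ℕ → ℝ) (t : ℝ) : ℕ := sInf {j : ℕ | 1 ≤ j ∧ j ≤ s ∧ t ≤ h j}

/-- The segment `(h_{p(t)-1}, h_{p(t)}]`. -/
def segment (s : ℕ) (h : ℕ → ℝ) (t : ℝ) : Set ℝ :=
  Set.Ioc (h (segIndex s h t - 1)) (h (segIndex s h t))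

open Classical in
/-- The segment-based dynamic projection of width `kc` of the function `x`, at time `t`. -/
def proj (s : ℕ) (h : ℕ → ℝ) (kc : ℝ) (x : ℝ → ℝ) (t : ℝ) : ℝ :=
  if x t > sSup (x '' segment s h t) - kc then x t else sSup (x '' segment s h t) - kc

end DualILC

end

noncomputable section

namespace DualILC

open MeasureTheory Set

/-! Write x for the dual velocity error, A for the pose error, e = ‖x_r‖ + ‖x_c‖, and g = crs(x,
func(x, …)) for the signal that drives the learning. Three facts combine.

Dissipation. The energy V is the kinetic energy of x plus kp (‖A_r - ς‖² + ‖A_c‖²). Gyroscopic terms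
quadratic in x cancel, and every remaining perturbation is dominated by g, so V' ≤ (Θ - θ̂_k) g
almost everywhere, with Θ independent of k (`energy_rate_le`). The estimates start at 0 and never
decrease in k, so V' ≤ Θ g ≤ G (V + 1), and Grönwall's inequality bounds V uniformly in k.

Decay. If θ̂_k ≥ Θ on (a, b], then V does not increase there, so e(t) is controlled by the errors at
a. The pose error starts at exactly ±1, hence at time a it is at most a constant times ∫₀ᵃ e.
Together, e(t) ≤ C (e(a) + ∫₀ᵃ e) (`exists_trajectory_bounds`).

Learning. Suppose Σ_k e_k is bounded on [0, h_j]. On the next segment, either no estimate ever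
passes Θ + kc, or one does at a single point; the projection then lifts the estimate above Θ on the
whole segment in all later iterations. From then on decay applies and the increments kθ g_k are
summable by the induction hypothesis, so the estimates stay bounded (`estimate_bounded_on_segment`).
Telescoping the update law turns bounded estimates into a bound on Σ_k e_k on that segment.
Induction over the segments covers [0, T] (`learning_bounded`).

Finally the pose error in iteration k is at most C ∫₀ᵗ e_k, which is summable in k and so tends to
0. -/

/-! ### Absolutely continuous functions -/

/-- The composition of an absolutely continuous function with a continuous linear map. -/
theorem absolutelyContinuous_clm_comp {E F : Type*} [NormedAddCommGroup E] [NormedSpace ℝ E]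
    [NormedAddCommGroup F] [NormedSpace ℝ F] (L : E →L[ℝ] F) {f : ℝ → E} {a b : ℝ}
    (hf : AbsolutelyContinuousOnInterval f a b) :
    AbsolutelyContinuousOnInterval (fun t => L (f t)) a b := by
  have h := Filter.Tendsto.const_mul ‖L‖ hf
  rw [mul_zero] at h
  refine squeeze_zero (fun E => Finset.sum_nonneg fun i _ => dist_nonneg) (fun E => ?_) h
  rw [Finset.mul_sum]
  exact Finset.sum_le_sum fun i _ => L.dist_le_opNorm _ _

theorem absolutelyContinuous_of_hasDerivWithinAt {E : Type*} [NormedAddCommGroup E]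
    [NormedSpace ℝ E] {f f' : ℝ → E} {a b C : ℝ} (hab : a ≤ b)
    (hf : ∀ t ∈ Icc a b, HasDerivWithinAt f (f' t) (Icc a b) t)
    (hC : ∀ t ∈ Icc a b, ‖f' t‖ ≤ C) : AbsolutelyContinuousOnInterval f a b := by
  have hC0 : 0 ≤ C := (norm_nonneg _).trans (hC a ⟨le_rfl, hab⟩)
  have h := Convex.lipschitzOnWith_of_nnnorm_hasDerivWithin_le (C := ⟨C, hC0⟩) (convex_Icc a b) hf
    (fun t ht => hC t ht)
  rw [← uIcc_of_le hab] at h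
  exact h.absolutelyContinuousOnInterval

/-- An absolutely continuous function is the integral of its almost-everywhere derivative. Such a
monotonicity criterion is needed because Filippov solutions satisfy the dynamics only for almost
every time. -/
theorem le_of_ae_hasDerivAt_nonpos {V : ℝ → ℝ} {T a b : ℝ}
    (hV : AbsolutelyContinuousOnInterval V 0 T) (ha : 0 ≤ a) (hab : a ≤ b) (hb : b ≤ T)
    (h : ∀ᵐ t ∂(volume.restrict (Icc 0 T)), t ∈ Ioc a b → ∃ v, HasDerivAt V v t ∧ v ≤ 0) :
    V b ≤ V a := by
  have hsub : Icc a b ⊆ Icc 0 T := Icc_subset_Icc ha hb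
  have hV' : AbsolutelyContinuousOnInterval V a b := by
    refine hV.mono ?_
    rwa [uIcc_of_le hab, uIcc_of_le (ha.trans (hab.trans hb))]
  have hint := hV'.integral_deriv_eq_sub
  have hle : ∫ t in a..b, deriv V t ≤ ∫ _t in a..b, (0 : ℝ) := by
    refine intervalIntegral.integral_mono_ae_restrict hab hV'.intervalIntegrable_deriv
      (by simp) ?_
    have h1 := ae_restrict_of_ae_restrict_of_subset hsub h
    have h2 : ∀ᵐ t ∂(volume.restrict (Icc a b)), t ≠ a := by
      refine ae_restrict_of_ae ?_
      simp [ae_iff]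
    filter_upwards [h1, h2, ae_restrict_mem measurableSet_Icc] with t h1 h2 h3
    obtain ⟨v, hv, hv0⟩ := h1 ⟨lt_of_le_of_ne h3.1 (Ne.symm h2), h3.2⟩
    simpa [hv.deriv] using hv0
  rw [hint] at hle
  simp at hle
  exact hle

/-- Grönwall by integrating factor: (V + 1) exp(-Cτ) is absolutely continuous with nonpositive
derivative almost everywhere. -/
theorem le_exp_of_ae_hasDerivAt_le {V : ℝ → ℝ} {T C : ℝ}
    (hV : AbsolutelyContinuousOnInterval V 0 T)
    (h : ∀ᵐ t ∂(volume.restrict (Icc 0 T)), ∃ v, HasDerivAt V v t ∧ v ≤ C * (V t + 1))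
    {t : ℝ} (ht : t ∈ Icc 0 T) : V t + 1 ≤ (V 0 + 1) * Real.exp (C * t) := by
  have h1 : ∀ r, HasDerivAt (fun τ => Real.exp (-C * τ)) (Real.exp (-C * r) * (-C)) r := fun r => by
    simpa using ((hasDerivAt_id r).const_mul (-C)).exp
  have hone : AbsolutelyContinuousOnInterval (fun _ : ℝ => (1 : ℝ)) 0 T :=
    (LipschitzWith.const (1 : ℝ)).lipschitzOnWith.absolutelyContinuousOnInterval
  have hexp : AbsolutelyContinuousOnInterval (fun τ => Real.exp (-C * τ)) 0 T := by
    refine ContDiffOn.absolutelyContinuousOnInterval (ContDiff.contDiffOn ?_)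
    fun_prop
  have hW := (hV.add hone).mul hexp
  have := le_of_ae_hasDerivAt_nonpos hW le_rfl ht.1 ht.2 (by
    filter_upwards [h] with r hr _
    obtain ⟨v, hv, hvC⟩ := hr
    refine ⟨_, (hv.add (hasDerivAt_const r (1 : ℝ))).mul (h1 r), ?_⟩
    have := mul_nonneg (sub_nonneg.2 hvC) (Real.exp_pos (-C * r)).le
    simp only [Pi.add_apply]
    linarith)
  simp only [Pi.mul_apply, Pi.add_apply, mul_zero, Real.exp_zero, mul_one] at this
  have h2 := mul_le_mul_of_nonneg_right this (Real.exp_pos (C * t)).le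
  rwa [mul_assoc, ← Real.exp_add, neg_mul, neg_add_cancel, Real.exp_zero, mul_one] at h2

theorem norm_sub_le_integral {E : Type*} [NormedAddCommGroup E] [NormedSpace ℝ E] [CompleteSpace E]
    {f f' : ℝ → E} {e : ℝ → ℝ} {T C t : ℝ} (ht : t ∈ Icc 0 T)
    (hf : ∀ t ∈ Icc 0 T, HasDerivWithinAt f (f' t) (Icc 0 T) t)
    (hf' : ContinuousOn f' (Icc 0 T)) (he : ContinuousOn e (Icc 0 T))
    (hC : ∀ t ∈ Icc 0 T, ‖f' t‖ ≤ C * e t) : ‖f t - f 0‖ ≤ C * ∫ τ in (0)..t, e τ := by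
  have hsub : Icc 0 t ⊆ Icc 0 T := Icc_subset_Icc le_rfl ht.2
  have hcont : ContinuousOn f (Icc 0 t) := fun r hr =>
    (hf r (hsub hr)).continuousWithinAt.mono hsub
  rw [← intervalIntegral.integral_eq_sub_of_hasDerivAt_of_le ht.1 hcont
    (fun r hr => (hf r ⟨hr.1.le, hr.2.le.trans ht.2⟩).hasDerivAt
      (Icc_mem_nhds hr.1 (hr.2.trans_le ht.2)))
    ((hf'.mono hsub).intervalIntegrable_of_Icc ht.1), ← intervalIntegral.integral_const_mul]
  refine intervalIntegral.norm_integral_le_of_norm_le ht.1 ?_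
    ((continuousOn_const.mul (he.mono hsub)).intervalIntegrable_of_Icc ht.1)
  exact Filter.Eventually.of_forall fun r hr => hC r (hsub ⟨hr.1.le, hr.2⟩)

/-! ### Segments and the dynamic projection -/

section Learning

variable {s : ℕ} {h : ℕ → ℝ}

theorem breakpoint_le (hmono : ∀ j < s, h j < h (j + 1)) {i j : ℕ} (hij : i ≤ j) (hj : j ≤ s) :
    h i ≤ h j := by
  induction j, hij using Nat.le_induction with
  | base => exact le_rfl
  | succ n hn ih => exact (ih (by omega)).trans (hmono n (by omega)).le

theorem segIndex_eq (hmono : ∀ j < s, h j < h (j + 1)) {j : ℕ} (hj : j < s) {t : ℝ}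
    (ht : t ∈ Ioc (h j) (h (j + 1))) : segIndex s h t = j + 1 := by
  refine IsLeast.csInf_eq ⟨⟨by omega, by omega, ht.2⟩, fun i hi => ?_⟩
  by_contra hlt
  have := breakpoint_le hmono (i := i) (j := j) (by omega) hj.le
  linarith [ht.1, hi.2.2]

theorem segment_eq (hmono : ∀ j < s, h j < h (j + 1)) {j : ℕ} (hj : j < s) {t : ℝ}
    (ht : t ∈ Ioc (h j) (h (j + 1))) : segment s h t = Ioc (h j) (h (j + 1)) := by
  simp [segment, segIndex_eq hmono hj ht]

theorem segment_zero (hmono : ∀ j < s, h j < h (j + 1)) (hs : 1 ≤ s) (h0 : h 0 = 0) :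
    segment s h 0 = Ioc (h 0) (h 1) := by
  have : segIndex s h 0 = 1 := by
    refine IsLeast.csInf_eq ⟨⟨le_rfl, hs, ?_⟩, fun i hi => hi.1⟩
    exact h0 ▸ (hmono 0 hs).le
  simp [segment, this]

theorem le_proj (kc : ℝ) (x : ℝ → ℝ) (t : ℝ) : x t ≤ proj s h kc x t := by
  unfold proj
  split_ifs with hx
  · exact le_rfl
  · exact not_lt.1 hx

theorem sSup_sub_le_proj (kc : ℝ) (x : ℝ → ℝ) (t : ℝ) :
    sSup (x '' segment s h t) - kc ≤ proj s h kc x t := by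
  unfold proj
  split_ifs with hx
  · exact hx.le
  · exact le_rfl

theorem proj_le {kc : ℝ} (hkc : 0 < kc) {x : ℝ → ℝ} {t B : ℝ} (hne : (segment s h t).Nonempty)
    (ht : x t ≤ B) (hB : ∀ τ ∈ segment s h t, x τ ≤ B) : proj s h kc x t ≤ B := by
  have : sSup (x '' segment s h t) ≤ B :=
    csSup_le (hne.image x) (by rintro _ ⟨τ, hτ, rfl⟩; exact hB τ hτ)
  unfold proj
  split_ifs <;> linarith

/-! ### Boundedness of the learned estimates -/

variable {T kc kl kθ Θ C D : ℝ} {θ g e : ℕ → ℝ → ℝ}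

/-- The projection never lowers a value, and the saturated increment is nonnegative because g is. -/
theorem estimate_monotone (hkl : 0 < kl) (hkθ : 0 < kθ)
    (hg : ∀ k, ∀ t ∈ Icc 0 T, 0 ≤ g k t)
    (hθ : ∀ k, ∀ t ∈ Icc 0 T, θ (k + 1) t - proj s h kc (θ k) t = min kl (kθ * g (k + 1) t))
    {t : ℝ} (ht : t ∈ Icc 0 T) : Monotone fun k => θ k t := by
  refine monotone_nat_of_le_succ fun k => ?_
  have h1 := hθ k t ht
  have h2 : 0 ≤ min kl (kθ * g (k + 1) t) := le_min hkl.le (mul_nonneg hkθ.le (hg _ t ht))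
  have h3 := le_proj (s := s) (h := h) kc (θ k) t
  linarith

/-- On one segment, the estimates stay bounded if the amounts `r k` by which the error can exceed
zero once the estimate has passed the threshold `Θ` have bounded partial sums. -/
theorem estimate_bounded_on_segment (hT : h s = T) (h0 : h 0 = 0)
    (hmono : ∀ j < s, h j < h (j + 1)) (hkc : 0 < kc) (hkl : 0 < kl) (hkθ : 0 < kθ) (hΘ : 0 ≤ Θ)
    (hg : ∀ k, ∀ t ∈ Icc 0 T, 0 ≤ g k t) (hθ0 : ∀ t ∈ Icc 0 T, θ 0 t = 0)
    (hθ : ∀ k, ∀ t ∈ Icc 0 T, θ (k + 1) t - proj s h kc (θ k) t = min kl (kθ * g (k + 1) t))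
    {j : ℕ} (hj : j < s) {r : ℕ → ℝ} {R : ℝ} (hr0 : ∀ k, 0 ≤ r k)
    (hR : ∀ n, ∑ k ∈ Finset.range n, r k ≤ R)
    (hr : ∀ k, (∀ t ∈ Ioc (h j) (h (j + 1)), Θ ≤ θ k t) →
      ∀ t ∈ Ioc (h j) (h (j + 1)), g k t ≤ r k) :
    ∀ k, ∀ t ∈ Ioc (h j) (h (j + 1)), θ k t ≤ Θ + kc + kl + kθ * R := by
  set I := Ioc (h j) (h (j + 1)) with hI
  have hR0 : 0 ≤ R := by simpa using hR 0
  have hIne : I.Nonempty := nonempty_Ioc.2 (hmono j hj)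
  have hIT : I ⊆ Icc 0 T := fun t ht =>
    ⟨by have := breakpoint_le hmono (Nat.zero_le j) hj.le; linarith [ht.1],
      by have := breakpoint_le hmono (Nat.succ_le_of_lt hj) le_rfl; linarith [ht.2]⟩
  have hseg : ∀ t ∈ I, segment s h t = I := fun t ht => segment_eq hmono hj ht
  have hmonoθ : ∀ t ∈ I, Monotone fun k => θ k t := fun t ht =>
    estimate_monotone hkl hkθ hg hθ (hIT ht)
  have hprojle : ∀ k B, (∀ t ∈ I, θ k t ≤ B) → ∀ t ∈ I, proj s h kc (θ k) t ≤ B :=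
    fun k B hB t ht => proj_le hkc (by rwa [hseg t ht]) (hB t ht) (by rwa [hseg t ht])
  have hstep : ∀ k B, (∀ t ∈ I, θ k t ≤ B) → ∀ t ∈ I, θ (k + 1) t ≤ B + kl := by
    intro k B hB t ht
    have h1 := hθ k t (hIT ht)
    have h2 := hprojle k B hB t ht
    have h3 := min_le_left kl (kθ * g (k + 1) t)
    linarith
  -- The real `sSup` of an unbounded set is 0, so the projection is a genuine supremum only after
  -- this check. Saturation gives the crude bound k * kl.
  have hbdd : ∀ k, BddAbove (θ k '' I) := by
    have : ∀ k : ℕ, ∀ t ∈ I, θ k t ≤ k * kl := by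
      intro k
      induction k with
      | zero => intro t ht; simp [hθ0 t (hIT ht)]
      | succ k ih =>
        intro t ht
        have := hstep k _ ih t ht
        push_cast
        linarith
    exact fun k => ⟨k * kl, by rintro _ ⟨t, ht, rfl⟩; exact this k t ht⟩
  by_cases hA : ∀ k, ∀ t ∈ I, θ k t ≤ Θ + kc
  · intro k t ht
    have := hA k t ht
    have := mul_nonneg hkθ.le hR0
    linarith
  push Not at hA
  classical
  -- K is the first iteration whose estimate exceeds Θ + kc somewhere on the segment, at t₀. By
  -- saturation it overshoots by at most kl.
  obtain ⟨t₀, ht₀, hK⟩ := Nat.find_spec hA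
  have hKmin : ∀ k < Nat.find hA, ∀ t ∈ I, θ k t ≤ Θ + kc := by
    intro k hk
    have := Nat.find_min hA hk
    push Not at this
    exact this
  set K := Nat.find hA
  have hKle : ∀ t ∈ I, θ K t ≤ Θ + kc + kl := by
    intro t ht
    rcases hKe : K with _ | k
    · rw [hθ0 t (hIT ht)]
      positivity
    · exact hstep k _ (hKmin k (by omega)) t ht
  -- The value at t₀ persists by monotonicity, so the supremum over the segment minus kc stays above
  -- Θ and the projection transfers this to every point of the segment.
  have hlarge : ∀ k, ∀ t ∈ I, Θ ≤ θ (K + k + 1) t := by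
    intro k t ht
    have h1 := hθ (K + k) t (hIT ht)
    have h2 : 0 ≤ min kl (kθ * g (K + k + 1) t) :=
      le_min hkl.le (mul_nonneg hkθ.le (hg _ t (hIT ht)))
    have h3 := sSup_sub_le_proj (s := s) (h := h) kc (θ (K + k)) t
    rw [hseg t ht] at h3
    have h4 := le_csSup (hbdd (K + k)) (mem_image_of_mem _ ht₀)
    have h5 : θ K t₀ ≤ θ (K + k) t₀ := hmonoθ t₀ ht₀ (Nat.le_add_right K k)
    linarith
  have hgrow : ∀ i, ∀ t ∈ I,
      θ (K + i) t ≤ Θ + kc + kl + kθ * ∑ l ∈ Finset.range i, r (K + l + 1) := by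
    intro i
    induction i with
    | zero => simpa using hKle
    | succ i ih =>
      intro t ht
      have h1 := hθ (K + i) t (hIT ht)
      have h2 := hprojle (K + i) _ ih t ht
      have h3 := min_le_right kl (kθ * g (K + i + 1) t)
      have h4 := mul_le_mul_of_nonneg_left (hr (K + i + 1) (hlarge i) t ht) hkθ.le
      rw [Finset.sum_range_succ, mul_add, ← add_assoc K i 1]
      linarith
  intro k t ht
  have h1 := hgrow k t ht
  have h2 : θ k t ≤ θ (K + k) t := hmonoθ t ht (Nat.le_add_left k K)
  have h3 : ∑ l ∈ Finset.range k, r (K + l + 1) ≤ R := by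
    refine le_trans ?_ (hR (K + 1 + k))
    rw [Finset.sum_range_add]
    have h4 : ∑ l ∈ Finset.range k, r (K + l + 1) = ∑ l ∈ Finset.range k, r (K + 1 + l) :=
      Finset.sum_congr rfl fun l _ => by congr 1; omega
    have h5 : 0 ≤ ∑ l ∈ Finset.range (K + 1), r l := Finset.sum_nonneg fun l _ => hr0 l
    linarith
  have h4 := mul_le_mul_of_nonneg_left h3 hkθ.le
  linarith

theorem sum_integral_le {a B : ℝ} (ha : 0 ≤ a) (hec : ∀ k, ContinuousOn (e k) (Icc 0 a))
    (hB : ∀ t ∈ Icc 0 a, ∀ n, ∑ k ∈ Finset.range n, e k t ≤ B) (n : ℕ) :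
    ∑ k ∈ Finset.range n, ∫ τ in (0)..a, e k τ ≤ B * a := by
  rw [← intervalIntegral.integral_finsetSum fun k _ => (hec k).intervalIntegrable_of_Icc ha]
  have h1 : IntervalIntegrable (fun τ => ∑ k ∈ Finset.range n, e k τ) volume 0 a :=
    ContinuousOn.intervalIntegrable_of_Icc ha (continuousOn_finsetSum _ fun k _ => hec k)
  refine (intervalIntegral.integral_mono_on ha h1 (g := fun _ => B) (by simp)
    fun τ hτ => hB τ hτ n).trans ?_
  simp [mul_comm]

/-- Iterative learning with the saturated update and the segment-based projection: if the error
`e k` decays as soon as the estimate exceeds the threshold `Θ`, then the errors are summable over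
the iterations, uniformly in time, and the estimates are bounded. -/
theorem learning_bounded (hs : 1 ≤ s) (hT : h s = T) (h0 : h 0 = 0)
    (hmono : ∀ j < s, h j < h (j + 1)) (hkc : 0 < kc) (hkl : 0 < kl) (hkθ : 0 < kθ) (hΘ : 0 ≤ Θ)
    (hC : 0 ≤ C) (hD : 0 < D) (hθ0 : ∀ t ∈ Icc 0 T, θ 0 t = 0)
    (hθ : ∀ k, ∀ t ∈ Icc 0 T, θ (k + 1) t - proj s h kc (θ k) t = min kl (kθ * g (k + 1) t))
    (hec : ∀ k, ContinuousOn (e k) (Icc 0 T)) (he0 : ∀ k, ∀ t ∈ Icc 0 T, 0 ≤ e k t)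
    (heD : ∀ k, ∀ t ∈ Icc 0 T, e k t ≤ D) (hinit : ∀ k, e k 0 = 0)
    (heg : ∀ k, ∀ t ∈ Icc 0 T, e k t ≤ g k t) (hge : ∀ k, ∀ t ∈ Icc 0 T, g k t ≤ C * e k t)
    (hdecay : ∀ k a b, 0 ≤ a → a ≤ b → b ≤ T → (∀ t ∈ Ioc a b, Θ ≤ θ k t) →
      ∀ t ∈ Ioc a b, e k t ≤ C * (e k a + ∫ τ in (0)..a, e k τ)) :
    ∃ B, ∀ t ∈ Icc 0 T, (∀ n, ∑ k ∈ Finset.range n, e k t ≤ B) ∧ ∀ k, |θ k t| ≤ B := by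
  have hg : ∀ k, ∀ t ∈ Icc 0 T, 0 ≤ g k t := fun k t ht => (he0 k t ht).trans (heg k t ht)
  have hmonoθ : ∀ t ∈ Icc 0 T, Monotone fun k => θ k t := fun t ht =>
    estimate_monotone hkl hkθ hg hθ ht
  have hθnn : ∀ k, ∀ t ∈ Icc 0 T, 0 ≤ θ k t := fun k t ht =>
    (hθ0 t ht).symm.le.trans (hmonoθ t ht (Nat.zero_le k))
  -- Since e ≤ D, saturation at kl costs only a constant: the increment still dominates a fixed
  -- multiple of e.
  obtain ⟨c, hc, hcmin⟩ : ∃ c, 0 < c ∧ ∀ k, ∀ t ∈ Icc 0 T, c * e k t ≤ min kl (kθ * g k t) := by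
    refine ⟨min (kl / D) kθ, lt_min (div_pos hkl hD) hkθ, fun k t ht => le_min ?_ ?_⟩
    · calc min (kl / D) kθ * e k t ≤ kl / D * D :=
            mul_le_mul (min_le_left _ _) (heD k t ht) (he0 k t ht) (div_pos hkl hD).le
        _ = kl := div_mul_cancel₀ _ hD.ne'
    · exact mul_le_mul (min_le_right _ _) (heg k t ht) (he0 k t ht) hkθ.le
  -- Telescoping the update bounds the sum of e over iterations 1, 2, …; iteration 0 has no update
  -- and contributes the extra D.
  have hsum : ∀ t ∈ Icc 0 T, ∀ B, (∀ k, θ k t ≤ B) → ∀ n,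
      ∑ k ∈ Finset.range n, e k t ≤ D + B / c := by
    intro t ht B hB n
    have h1 : ∀ n, c * ∑ k ∈ Finset.range n, e (k + 1) t ≤ θ n t := by
      intro n
      induction n with
      | zero => simp [hθ0 t ht]
      | succ n ih =>
        rw [Finset.sum_range_succ, mul_add]
        have h1 := hθ n t ht
        have h2 := hcmin (n + 1) t ht
        have h3 := le_proj (s := s) (h := h) kc (θ n) t
        linarith
    have h2 : ∑ k ∈ Finset.range n, e (k + 1) t ≤ B / c := by
      rw [le_div_iff₀ hc, mul_comm]
      exact (h1 n).trans (hB n)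
    calc ∑ k ∈ Finset.range n, e k t ≤ ∑ k ∈ Finset.range (n + 1), e k t := by
          rw [Finset.sum_range_succ]
          linarith [he0 n t ht]
      _ = ∑ k ∈ Finset.range n, e (k + 1) t + e 0 t := Finset.sum_range_succ' _ _
      _ ≤ D + B / c := by linarith [heD 0 t ht]
  have hTpos : 0 < h 1 := h0 ▸ hmono 0 hs
  have hhT : ∀ j ≤ s, 0 ≤ h j ∧ h j ≤ T := fun j hj =>
    ⟨h0 ▸ breakpoint_le hmono (Nat.zero_le j) hj, hT ▸ breakpoint_le hmono hj le_rfl⟩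
  -- Segments are open on the left, so time 0 belongs to none of them; the estimates there are
  -- treated separately in `hzero`.
  have hind : ∀ j ≤ s, ∃ B, 0 ≤ B ∧ (∀ t ∈ Icc 0 (h j), ∀ n, ∑ k ∈ Finset.range n, e k t ≤ B) ∧
      ∀ t ∈ Ioc 0 (h j), ∀ k, θ k t ≤ B := by
    intro j
    induction j with
    | zero =>
      intro _
      refine ⟨0, le_rfl, fun t ht n => ?_, fun t ht => ?_⟩
      · have : t = 0 := le_antisymm (h0 ▸ ht.2) ht.1
        simp [this, hinit]
      · rw [h0] at ht
        exact absurd ht.1 (not_lt.2 ht.2)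
    | succ j ih =>
      intro hj
      obtain ⟨B, hB0, hBe, hBθ⟩ := ih (by omega)
      have hjT := hhT j (by omega)
      have hjT' := hhT (j + 1) hj
      have hIT : Ioc (h j) (h (j + 1)) ⊆ Icc 0 T := fun t ht =>
        ⟨hjT.1.trans ht.1.le, ht.2.trans hjT'.2⟩
      have hsub : Icc 0 (h j) ⊆ Icc 0 T := Icc_subset_Icc le_rfl hjT.2
      have hintsum := sum_integral_le hjT.1 (fun k => (hec k).mono hsub) hBe
      have hintnn : ∀ k, 0 ≤ ∫ τ in (0)..(h j), e k τ := fun k =>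
        intervalIntegral.integral_nonneg hjT.1 fun τ hτ => he0 k τ (hsub hτ)
      -- The outer C comes from g ≤ C e, the inner one from the decay estimate with a = h j. Only
      -- errors on earlier segments enter, and these are summable by induction.
      have hθI := estimate_bounded_on_segment (r := fun k =>
          C * (C * (e k (h j) + ∫ τ in (0)..(h j), e k τ))) (R := C * (C * (B + B * h j)))
        hT h0 hmono hkc hkl hkθ hΘ hg hθ0 hθ (Nat.lt_of_succ_le hj)
        (fun k => mul_nonneg hC (mul_nonneg hC (add_nonneg (he0 k _ hjT) (hintnn k))))
        (fun n => by
          rw [← Finset.mul_sum, ← Finset.mul_sum, Finset.sum_add_distrib]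
          gcongr
          · exact hBe _ ⟨hjT.1, le_rfl⟩ n
          · exact hintsum n)
        (fun k hk t ht => (hge k t (hIT ht)).trans (mul_le_mul_of_nonneg_left
          (hdecay k _ _ hjT.1 (ht.1.le.trans ht.2) hjT'.2 hk t ht) hC))
      set B₁ := Θ + kc + kl + kθ * (C * (C * (B + B * h j)))
      refine ⟨max B (max (D + B₁ / c) B₁), hB0.trans (le_max_left _ _), fun t ht n => ?_,
        fun t ht k => ?_⟩
      · rcases le_or_gt t (h j) with htj | htj
        · exact (hBe t ⟨ht.1, htj⟩ n).trans (le_max_left _ _)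
        · exact (hsum t (hIT ⟨htj, ht.2⟩) B₁ (fun k => hθI k t ⟨htj, ht.2⟩) n).trans
            ((le_max_left _ _).trans (le_max_right _ _))
      · rcases le_or_gt t (h j) with htj | htj
        · exact (hBθ t ⟨ht.1, htj⟩ k).trans (le_max_left _ _)
        · exact (hθI k t ⟨htj, ht.2⟩).trans ((le_max_right _ _).trans (le_max_right _ _))
  obtain ⟨B, hB0, hBe, hBθ⟩ := hind s le_rfl
  rw [hT] at hBe hBθ
  have h1T := (hhT 1 hs).2
  have h0T : (0 : ℝ) ∈ Icc 0 T := ⟨le_rfl, hTpos.le.trans h1T⟩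
  -- At time 0 the increment vanishes because the velocity error does, and the projection takes its
  -- supremum over the first segment, where B already applies.
  have hzero : ∀ k, θ k 0 ≤ B := by
    intro k
    induction k with
    | zero => rw [hθ0 0 h0T]; exact hB0
    | succ k ih =>
      have h1 := hθ k 0 h0T
      have h2 : proj s h kc (θ k) 0 ≤ B := by
        refine proj_le hkc ?_ ih ?_ <;> rw [segment_zero hmono hs h0]
        · exact nonempty_Ioc.2 (hmono 0 hs)
        · exact fun τ hτ => hBθ τ ⟨h0 ▸ hτ.1, hτ.2.trans h1T⟩ k
      have h3 := min_le_right kl (kθ * g (k + 1) 0)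
      have h4 := mul_le_mul_of_nonneg_left (hge (k + 1) 0 h0T) hkθ.le
      rw [hinit, mul_zero, mul_zero] at h4
      linarith
  refine ⟨B, fun t ht => ⟨hBe t ht, fun k => ?_⟩⟩
  rw [abs_of_nonneg (hθnn k t ht)]
  rcases ht.1.eq_or_lt with rfl | h
  · exact hzero k
  · exact hBθ t ⟨h, ht.2⟩ k

end Learning

/-! ### Algebra of dual quaternions and vectors -/

@[simp] theorem re_mkDQ (a b : ℍ[ℝ]) : re (mkDQ a b) = a := by simp [re, mkDQ]

@[simp] theorem du_mkDQ (a b : ℍ[ℝ]) : du (mkDQ a b) = b := by simp [du, mkDQ]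

theorem dualQuat_ext {A B : DualQuat} (h₁ : re A = re B) (h₂ : du A = du B) : A = B :=
  TrivSqZeroExt.ext h₁ h₂

@[simp] theorem re_mul (A B : DualQuat) : re (A * B) = re A * re B := rfl

@[simp] theorem du_mul (A B : DualQuat) : du (A * B) = re A * du B + du A * re B := by
  simp [du, re, TrivSqZeroExt.snd_mul]

@[simp] theorem re_smul (r : ℝ) (A : DualQuat) : re (r • A) = r • re A := rfl

@[simp] theorem du_smul (r : ℝ) (A : DualQuat) : du (r • A) = r • du A := rfl

@[simp] theorem re_add (A B : DualQuat) : re (A + B) = re A + re B := rfl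

@[simp] theorem du_add (A B : DualQuat) : du (A + B) = du A + du B := rfl

@[simp] theorem re_sub (A B : DualQuat) : re (A - B) = re A - re B := rfl

@[simp] theorem du_sub (A B : DualQuat) : du (A - B) = du A - du B := rfl

@[simp] theorem re_neg (A : DualQuat) : re (-A) = -re A := rfl

@[simp] theorem du_neg (A : DualQuat) : du (-A) = -du A := rfl

@[simp] theorem re_one : re 1 = 1 := rfl

@[simp] theorem du_one : du 1 = 0 := rfl

@[simp] theorem re_conj (A : DualQuat) : re (conj A) = star (re A) := by simp [conj]

@[simp] theorem du_conj (A : DualQuat) : du (conj A) = star (du A) := by simp [conj]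

theorem conj_mul (A B : DualQuat) : conj (A * B) = conj B * conj A := by
  apply dualQuat_ext <;> simp [add_comm]

theorem conj_conj (A : DualQuat) : conj (conj A) = A := by
  apply dualQuat_ext <;> simp

theorem conj_smul (r : ℝ) (A : DualQuat) : conj (r • A) = r • conj A := by
  apply dualQuat_ext <;> simp

@[simp] theorem re_dualAug (x : DualVec) : re (dualAug x) = aug x.1 := by simp [dualAug]

@[simp] theorem du_dualAug (x : DualVec) : du (dualAug x) = aug x.2 := by simp [dualAug]

@[simp] theorem aug_re (x : E3) : (aug x).re = 0 := rfl

@[simp] theorem aug_imI (x : E3) : (aug x).imI = x 0 := rfl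

@[simp] theorem aug_imJ (x : E3) : (aug x).imJ = x 1 := rfl

@[simp] theorem aug_imK (x : E3) : (aug x).imK = x 2 := rfl

@[simp] theorem star_aug (x : E3) : star (aug x) = -aug x := by
  ext <;> simp

theorem conj_dualAug (x : DualVec) : conj (dualAug x) = -dualAug x := by
  apply dualQuat_ext <;> simp

theorem dualQuat_smul_mul (r : ℝ) (A B : DualQuat) : (r • A) * B = r • (A * B) := by
  apply dualQuat_ext <;> simp [smul_add]

theorem dualQuat_mul_smul (r : ℝ) (A B : DualQuat) : A * (r • B) = r • (A * B) := by
  apply dualQuat_ext <;> simp [smul_add]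

/-- The real part as a continuous linear map. -/
def reCLM : DualQuat →L[ℝ] ℍ[ℝ] :=
  ⟨(TrivSqZeroExt.fstHom ℝ ℍ[ℝ] ℍ[ℝ]).toLinearMap, TrivSqZeroExt.continuous_fst⟩

/-- The dual part as a continuous linear map. -/
def duCLM : DualQuat →L[ℝ] ℍ[ℝ] :=
  ⟨{ toFun := du, map_add' := fun _ _ => rfl, map_smul' := fun _ _ => rfl },
    TrivSqZeroExt.continuous_snd⟩

theorem continuous_mkDQ : Continuous fun p : ℍ[ℝ] × ℍ[ℝ] => mkDQ p.1 p.2 :=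
  (TrivSqZeroExt.continuous_inl.comp continuous_fst).add
    (TrivSqZeroExt.continuous_inr.comp continuous_snd)

/-- Conjugation as a continuous linear map. -/
def conjCLM : DualQuat →L[ℝ] DualQuat where
  toFun := conj
  map_add' A B := by apply dualQuat_ext <;> simp
  map_smul' r A := by apply dualQuat_ext <;> simp
  cont := continuous_mkDQ.comp ((continuous_star.comp reCLM.continuous).prodMk
    (continuous_star.comp duCLM.continuous))

/-- The vector part as a continuous linear map. -/
def redCLM : ℍ[ℝ] →L[ℝ] E3 :=
  LinearMap.toContinuousLinearMap
    { toFun := red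
      map_add' := fun A B => by ext i; fin_cases i <;> simp [red]
      map_smul' := fun r A => by ext i; fin_cases i <;> simp [red] }

/-- `aug` as a continuous linear map. -/
def augCLM : E3 →L[ℝ] ℍ[ℝ] :=
  LinearMap.toContinuousLinearMap
    { toFun := aug
      map_add' := fun A B => by ext <;> simp
      map_smul' := fun r A => by ext <;> simp }

theorem red_add (A B : ℍ[ℝ]) : red (A + B) = red A + red B := map_add redCLM A B

theorem red_sub (A B : ℍ[ℝ]) : red (A - B) = red A - red B := map_sub redCLM A B

theorem aug_add (x y : E3) : aug (x + y) = aug x + aug y := map_add augCLM x y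

theorem aug_smul (r : ℝ) (x : E3) : aug (r • x) = r • aug x := map_smul augCLM r x

theorem aug_sub (x y : E3) : aug (x - y) = aug x - aug y := map_sub augCLM x y

@[simp] theorem red_aug (x : E3) : red (aug x) = x := by
  ext i; fin_cases i <;> simp [red]

theorem aug_red {A : ℍ[ℝ]} (hA : star A = -A) : aug (red A) = A := by
  have h := congrArg QuaternionAlgebra.re hA
  simp at h
  ext <;> simp [red]
  linarith

theorem dualAug_dualRed {A : DualQuat} (hA : conj A = -A) : dualAug (dualRed A) = A := by
  apply dualQuat_ext
  · have h := congrArg re hA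
    simp only [re_conj, re_neg] at h
    simpa [dualRed] using aug_red h
  · have h := congrArg du hA
    simp only [du_conj, du_neg] at h
    simpa [dualRed] using aug_red h

theorem dualAug_sub (x y : DualVec) : dualAug (x - y) = dualAug x - dualAug y := by
  apply dualQuat_ext <;> simp [aug_sub]

theorem norm_sq_quaternion (a : ℍ[ℝ]) : ‖a‖ ^ 2 = a.re ^ 2 + a.imI ^ 2 + a.imJ ^ 2 + a.imK ^ 2 := by
  rw [sq, ← Quaternion.normSq_eq_norm_mul_self, Quaternion.normSq_def']

theorem norm_sq_vector (x : E3) : ‖x‖ ^ 2 = x 0 ^ 2 + x 1 ^ 2 + x 2 ^ 2 := by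
  simp [EuclideanSpace.norm_sq_eq, Fin.sum_univ_three]

theorem inner_vector (x y : E3) : inner ℝ x y = x 0 * y 0 + x 1 * y 1 + x 2 * y 2 := by
  simp [PiLp.inner_apply, Fin.sum_univ_three]
  ring

@[simp] theorem norm_aug (x : E3) : ‖aug x‖ = ‖x‖ := by
  refine (sq_eq_sq₀ (norm_nonneg _) (norm_nonneg _)).1 ?_
  rw [norm_sq_quaternion, norm_sq_vector]
  simp

theorem norm_red_le (a : ℍ[ℝ]) : ‖red a‖ ≤ ‖a‖ := by
  refine (sq_le_sq₀ (norm_nonneg _) (norm_nonneg _)).1 ?_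
  rw [norm_sq_quaternion, norm_sq_vector]
  simp [red]
  nlinarith [sq_nonneg a.re]

theorem cross_apply (x y : E3) :
    cross x y = !₂[x 1 * y 2 - x 2 * y 1, x 2 * y 0 - x 0 * y 2, x 0 * y 1 - x 1 * y 0] := by
  simp [cross, crossProduct]

theorem norm_cross_le (x y : E3) : ‖cross x y‖ ≤ ‖x‖ * ‖y‖ := by
  refine (sq_le_sq₀ (norm_nonneg _) (by positivity)).1 ?_
  rw [mul_pow, norm_sq_vector, norm_sq_vector, norm_sq_vector, cross_apply]
  simp
  nlinarith [sq_nonneg (x 0 * y 0 + x 1 * y 1 + x 2 * y 2)]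

theorem red_commutator (A : ℍ[ℝ]) (x : E3) :
    red ((1 / 2 : ℝ) • (A * aug x - aug x * A)) = cross (red A) x := by
  rw [cross_apply]
  ext i
  fin_cases i <;> simp [red] <;> ring

theorem dualRed_commutator (A : DualQuat) (x : DualVec) :
    dualRed ((1 / 2 : ℝ) • (A * dualAug x - dualAug x * A)) = dualCross (dualRed A) x := by
  refine Prod.ext ?_ ?_
  · simp only [dualRed, dualCross, re_smul, re_sub, re_mul, re_dualAug]
    exact red_commutator _ _
  · simp only [dualRed, dualCross, du_smul, du_sub, du_mul, re_dualAug, du_dualAug]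
    rw [← red_commutator, ← red_commutator, ← red_add]
    congr 1
    rw [← smul_add]
    congr 1
    abel

theorem sum_abs_ge_norm (x : E3) : ‖x‖ ≤ |x 0| + |x 1| + |x 2| := by
  refine (sq_le_sq₀ (norm_nonneg _) (by positivity)).1 ?_
  rw [norm_sq_vector, ← sq_abs (x 0), ← sq_abs (x 1), ← sq_abs (x 2)]
  nlinarith [mul_nonneg (abs_nonneg (x 0)) (abs_nonneg (x 1)),
    mul_nonneg (abs_nonneg (x 1)) (abs_nonneg (x 2)),
    mul_nonneg (abs_nonneg (x 0)) (abs_nonneg (x 2))]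

theorem abs_coord_le (x : E3) (i : Fin 3) : |x i| ≤ ‖x‖ := by
  simpa using PiLp.norm_apply_le x i

/-! ### Poses -/

/-- The two dual contributions cancel because conjugation changes the sign of `aug P`. -/
theorem pose_mul_conj {Q : ℍ[ℝ]} (hQ : ‖Q‖ = 1) (P : E3) : pose Q P * conj (pose Q P) = 1 := by
  have h : Q * star Q = 1 := by
    rw [Quaternion.self_mul_star, Quaternion.normSq_eq_norm_mul_self, hQ]; simp
  apply dualQuat_ext
  · simp [pose, h]
  · simp [pose, mul_assoc]

theorem conj_mul_pose {Q : ℍ[ℝ]} (hQ : ‖Q‖ = 1) (P : E3) : conj (pose Q P) * pose Q P = 1 := by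
  have h : star Q * Q = 1 := by
    rw [Quaternion.star_mul_self, Quaternion.normSq_eq_norm_mul_self, hQ]; simp
  apply dualQuat_ext
  · simp [pose, h]
  · simp [pose, mul_assoc, h]
    simp [← mul_assoc, h]

theorem poseErr_mul_conj {A B : DualQuat} (hA : conj A * A = 1) (hB : B * conj B = 1) :
    poseErr A B * conj (poseErr A B) = 1 := by
  rw [poseErr, conj_mul, conj_conj, mul_assoc, ← mul_assoc B, hB, one_mul, hA]

theorem hasDerivWithinAt_conj {A : ℝ → DualQuat} {A' : DualQuat} {S : Set ℝ} {t : ℝ}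
    (h : HasDerivWithinAt A A' S t) : HasDerivWithinAt (fun τ => conj (A τ)) (conj A') S t :=
  conjCLM.hasFDerivAt.comp_hasDerivWithinAt t h

theorem hasDerivWithinAt_dualQuat_mul {A B : ℝ → DualQuat} {A' B' : DualQuat} {S : Set ℝ} {t : ℝ}
    (hA : HasDerivWithinAt A A' S t) (hB : HasDerivWithinAt B B' S t) :
    HasDerivWithinAt (fun τ => A τ * B τ) (A' * B t + A t * B') S t :=
  HasDerivWithinAt.mul (𝕜 := ℝ) (𝔸 := DualQuat) hA hB

theorem conj_sandwich (A : DualQuat) (x : DualVec) :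
    conj (conj A * dualAug x * A) = -(conj A * dualAug x * A) := by
  rw [conj_mul, conj_mul, conj_conj, conj_dualAug]
  noncomm_ring

/-- The sandwich product is again a pure vector, so the vector part taken in `tr` discards nothing.
-/
theorem dualAug_tr (A : DualQuat) (x : DualVec) : dualAug (tr A x) = conj A * dualAug x * A :=
  dualAug_dualRed (conj_sandwich A x)

/-- The kinematics of the pose error. -/
theorem hasDerivWithinAt_poseErr {A B : ℝ → DualQuat} {u w : DualVec} {S : Set ℝ} {t : ℝ}
    (hA : HasDerivWithinAt A ((1 / 2 : ℝ) • (A t * dualAug u)) S t)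
    (hB : HasDerivWithinAt B ((1 / 2 : ℝ) • (B t * dualAug w)) S t)
    (hA1 : conj (A t) * A t = 1) (hB1 : B t * conj (B t) = 1) :
    HasDerivWithinAt (fun τ => poseErr (A τ) (B τ))
      ((1 / 2 : ℝ) • (poseErr (A t) (B t) * dualAug (velErr (poseErr (A t) (B t)) u w))) S t := by
  have h := hasDerivWithinAt_dualQuat_mul (hasDerivWithinAt_conj hA) hB
  refine h.congr_deriv ?_
  -- With δQ ∘ δQ* = 1 one gets δQ ∘ tr(u) = u ∘ δQ, which is the term produced by differentiating
  -- the desired pose.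
  have h1 := poseErr_mul_conj hA1 hB1
  rw [velErr, dualAug_sub, dualAug_tr, mul_sub, ← mul_assoc, ← mul_assoc, h1, one_mul, poseErr,
    conj_smul, conj_mul, conj_dualAug, smul_sub, dualQuat_smul_mul, dualQuat_mul_smul, neg_mul, neg_mul,
    smul_neg, mul_assoc, mul_assoc]
  abel

/-- The derivative of `tr(u)` along the error kinematics. -/
theorem hasDerivWithinAt_tr {A : ℝ → DualQuat} {u : ℝ → DualVec} {u' x : DualVec} {S : Set ℝ}
    {t : ℝ} (hA : HasDerivWithinAt A ((1 / 2 : ℝ) • (A t * dualAug x)) S t)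
    (hu : HasDerivWithinAt u u' S t) :
    HasDerivWithinAt (fun τ => tr (A τ) (u τ))
      (tr (A t) u' + dualCross (tr (A t) (u t)) x) S t := by
  have haug : HasDerivWithinAt (fun τ => dualAug (u τ)) (dualAug u') S t := by
    let L : DualVec →L[ℝ] DualQuat :=
      ⟨{ toFun := dualAug
         map_add' := fun x y => by apply dualQuat_ext <;> simp [aug_add]
         map_smul' := fun r x => by apply dualQuat_ext <;> simp [aug_smul] },
        continuous_mkDQ.comp ((augCLM.continuous.comp continuous_fst).prodMk
          (augCLM.continuous.comp continuous_snd))⟩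
    exact L.hasFDerivAt.comp_hasDerivWithinAt t hu
  let R : DualQuat →L[ℝ] DualVec := (redCLM.comp reCLM).prod (redCLM.comp duCLM)
  have h := R.hasFDerivAt.comp_hasDerivWithinAt t (hasDerivWithinAt_dualQuat_mul
    (hasDerivWithinAt_dualQuat_mul (hasDerivWithinAt_conj hA) haug) hA)
  refine h.congr_deriv ?_
  -- The motion of A contributes half a commutator with x, whose vector part is the dual cross
  -- product.
  have key : (conj ((1 / 2 : ℝ) • (A t * dualAug x)) * dualAug (u t) + conj (A t) * dualAug u') * A t
      + (conj (A t) * dualAug (u t)) * ((1 / 2 : ℝ) • (A t * dualAug x))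
      = conj (A t) * dualAug u' * A t
        + (1 / 2 : ℝ) • ((conj (A t) * dualAug (u t) * A t) * dualAug x
          - dualAug x * (conj (A t) * dualAug (u t) * A t)) := by
    rw [conj_smul, conj_mul, conj_dualAug, smul_sub, dualQuat_smul_mul, dualQuat_mul_smul, add_mul,
      dualQuat_smul_mul, neg_mul, neg_mul, neg_mul, smul_neg]
    simp only [mul_assoc]
    abel
  change R (_ + _) = _
  rw [key, map_add]
  exact congrArg₂ _ rfl (dualRed_commutator _ _)

/-! ### The inertia matrix -/

/-- The inertia matrix as a continuous linear map. -/
def inertiaCLM (J : Matrix (Fin 3) (Fin 3) ℝ) : E3 →L[ℝ] E3 :=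
  LinearMap.toContinuousLinearMap (Matrix.toEuclideanLin J)

theorem inertia_eq (m : ℝ) (J : Matrix (Fin 3) (Fin 3) ℝ) (x : DualVec) :
    inertia m J x = (m • x.2, inertiaCLM J x.1) := rfl

theorem inner_inertiaCLM_comm {J : Matrix (Fin 3) (Fin 3) ℝ} (hJ : J.PosDef) (x y : E3) :
    inner ℝ x (inertiaCLM J y) = inner ℝ (inertiaCLM J x) y :=
  ((Matrix.isSymmetric_toEuclideanLin_iff.2 hJ.isHermitian) x y).symm

theorem inner_inertiaCLM_pos {J : Matrix (Fin 3) (Fin 3) ℝ} (hJ : J.PosDef) {x : E3} (hx : x ≠ 0) :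
    0 < inner ℝ x (inertiaCLM J x) := by
  have h := hJ.dotProduct_mulVec_pos (x := x.ofLp) (fun h => hx (by ext i; simp [h]))
  have h2 : inner ℝ x (inertiaCLM J x) = star x.ofLp ⬝ᵥ (J.mulVec x.ofLp) := by
    rw [EuclideanSpace.inner_eq_star_dotProduct, dotProduct_comm]
    rfl
  rwa [h2]

/-- The quadratic form attains a positive minimum on the compact unit sphere; homogeneity extends
the bound to all vectors. -/
theorem exists_inner_inertiaCLM_ge {J : Matrix (Fin 3) (Fin 3) ℝ} (hJ : J.PosDef) :
    ∃ c > 0, ∀ x : E3, c * ‖x‖ ^ 2 ≤ inner ℝ x (inertiaCLM J x) := by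
  have hc : ContinuousOn (fun x : E3 => inner ℝ x (inertiaCLM J x)) (Metric.sphere 0 1) := by
    fun_prop
  obtain ⟨x₀, hx₀, hmin⟩ := (isCompact_sphere (0 : E3) 1).exists_isMinOn
    (NormedSpace.sphere_nonempty.2 zero_le_one) hc
  have hx₀' : x₀ ≠ 0 := fun h => by simp [h] at hx₀
  refine ⟨_, inner_inertiaCLM_pos hJ hx₀', fun x => ?_⟩
  rcases eq_or_ne x 0 with rfl | hx
  · simp
  have hn : ‖x‖ ≠ 0 := norm_ne_zero_iff.2 hx
  have h := hmin (show ‖x‖⁻¹ • x ∈ Metric.sphere (0 : E3) 1 by simp [norm_smul, hn])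
  simp only [mem_ofPred_eq, map_smul, inner_smul_left, inner_smul_right, conj_trivial] at h
  calc _ ≤ ‖x‖⁻¹ * (‖x‖⁻¹ * inner ℝ x (inertiaCLM J x)) * ‖x‖ ^ 2 :=
        mul_le_mul_of_nonneg_right h (sq_nonneg _)
    _ = inner ℝ x (inertiaCLM J x) := by field_simp

/-! ### The learning rate signal -/

/-- The `ℓ¹` norm. -/
def l1 (x : E3) : ℝ := |x 0| + |x 1| + |x 2|

theorem norm_le_l1 (x : E3) : ‖x‖ ≤ l1 x := sum_abs_ge_norm x

theorem l1_le (x : E3) : l1 x ≤ 3 * ‖x‖ := by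
  have h0 := abs_coord_le x 0
  have h1 := abs_coord_le x 1
  have h2 := abs_coord_le x 2
  unfold l1
  linarith

/-- The value of `crs(x, func(x, y, z))`. -/
def learnSignal (x y z : DualVec) : ℝ :=
  (‖cross y.1 y.2 + z.2‖ + 1) * l1 x.2 + (‖y.1‖ ^ 2 + ‖z.1‖ + 1) * l1 x.1

theorem mul_of_mem_sgnSet {v r : ℝ} (h : r ∈ SgnSet v) : v * r = |v| := by
  unfold SgnSet at h
  split_ifs at h with hv
  · simp [hv]
  · rw [mem_singleton_iff.1 h]
    rcases lt_or_gt_of_ne hv with hv | hv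
    · simp [Real.sign_of_neg hv, abs_of_neg hv]
    · simp [Real.sign_of_pos hv, abs_of_pos hv]

theorem abs_le_one_of_mem_sgnSet {v r : ℝ} (h : r ∈ SgnSet v) : |r| ≤ 1 := by
  unfold SgnSet at h
  split_ifs at h with hv
  · exact abs_le.2 h
  · rw [mem_singleton_iff.1 h]
    rcases lt_or_gt_of_ne hv with hv | hv
    · simp [Real.sign_of_neg hv]
    · simp [Real.sign_of_pos hv]

/-- Selections differ only at vanishing components, which contribute 0. Hence the update law, with
`sgn 0 = 0`, and the control, with any Filippov selection, see the same signal. -/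
theorem crs_funcOfSgn {σ x : DualVec} (h : IsSgnSelection σ x) (y z : DualVec) :
    crs x (funcOfSgn σ y z) = learnSignal x y z := by
  have h1 : inner ℝ x.1 σ.1 = l1 x.1 := by
    rw [inner_vector, mul_of_mem_sgnSet (h.1 0), mul_of_mem_sgnSet (h.1 1),
      mul_of_mem_sgnSet (h.1 2), l1]
  have h2 : inner ℝ x.2 σ.2 = l1 x.2 := by
    rw [inner_vector, mul_of_mem_sgnSet (h.2 0), mul_of_mem_sgnSet (h.2 1),
      mul_of_mem_sgnSet (h.2 2), l1]
  simp only [crs, funcOfSgn, inner_smul_right, h1, h2, learnSignal]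
  ring

theorem norm_sgnSelection_le {σ x : DualVec} (h : IsSgnSelection σ x) :
    ‖σ.1‖ ≤ 3 ∧ ‖σ.2‖ ≤ 3 := by
  constructor
  · refine (norm_le_l1 _).trans ?_
    have h0 := abs_le_one_of_mem_sgnSet (h.1 0)
    have h1 := abs_le_one_of_mem_sgnSet (h.1 1)
    have h2 := abs_le_one_of_mem_sgnSet (h.1 2)
    unfold l1
    linarith
  · refine (norm_le_l1 _).trans ?_
    have h0 := abs_le_one_of_mem_sgnSet (h.2 0)
    have h1 := abs_le_one_of_mem_sgnSet (h.2 1)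
    have h2 := abs_le_one_of_mem_sgnSet (h.2 2)
    unfold l1
    linarith

/-- This is the role of the summands 1 in `func`: the signal detects every velocity error, whatever
the desired motion. -/
theorem norm_le_learnSignal (x y z : DualVec) : ‖x.1‖ + ‖x.2‖ ≤ learnSignal x y z := by
  have h1 := norm_le_l1 x.1
  have h2 := norm_le_l1 x.2
  have h3 : 0 ≤ ‖cross y.1 y.2 + z.2‖ * l1 x.2 :=
    mul_nonneg (norm_nonneg _) ((norm_nonneg _).trans h2)
  have h4 : 0 ≤ (‖y.1‖ ^ 2 + ‖z.1‖) * l1 x.1 :=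
    mul_nonneg (by positivity) ((norm_nonneg _).trans h1)
  unfold learnSignal
  linarith

theorem tr_fst (A : DualQuat) (u : DualVec) : (tr A u).1 = red (star (re A) * aug u.1 * re A) := by
  simp [tr, dualRed]

theorem tr_snd (A : DualQuat) (u : DualVec) : (tr A u).2 =
    red (star (re A) * aug u.1 * du A +
      (star (re A) * aug u.2 + star (du A) * aug u.1) * re A) := by
  simp [tr, dualRed]

theorem norm_tr_fst_le {A : DualQuat} (hA : ‖re A‖ = 1) (u : DualVec) : ‖(tr A u).1‖ ≤ ‖u‖ := by
  rw [tr_fst]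
  refine (norm_red_le _).trans ?_
  simpa [norm_mul, hA] using norm_fst_le u

/-- Unlike the real part, the dual part of `tr` grows with the position error. The learning signal
is therefore quadratic in the errors, which the energy can still absorb. -/
theorem norm_tr_snd_le {A : DualQuat} (hA : ‖re A‖ = 1) (u : DualVec) :
    ‖(tr A u).2‖ ≤ (1 + 2 * ‖du A‖) * ‖u‖ := by
  rw [tr_snd, add_mul]
  refine (norm_red_le _).trans ((norm_add_le _ _).trans ((add_le_add le_rfl
    (norm_add_le _ _)).trans ?_))
  simp only [norm_mul, norm_star, norm_aug, hA, one_mul, mul_one]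
  have h1 := norm_fst_le u
  have h2 := norm_snd_le u
  have h3 := mul_le_mul_of_nonneg_left h1 (norm_nonneg (du A))
  linarith

/-- Bound of the coefficients of the learning signal. -/
theorem coeff_bound {A : DualQuat} (hA : ‖re A‖ = 1) {u u' : DualVec} {W : ℝ}
    (hu : ‖u‖ ≤ W) (hu' : ‖u'‖ ≤ W) :
    ‖cross (tr A u).1 (tr A u).2 + (tr A u').2‖ + 1 ≤ (W ^ 2 + W + 1) * (1 + 2 * ‖du A‖) ∧
      ‖(tr A u).1‖ ^ 2 + ‖(tr A u').1‖ + 1 ≤ W ^ 2 + W + 1 := by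
  have hW : 0 ≤ W := (norm_nonneg _).trans hu
  have hb : 0 ≤ ‖du A‖ := norm_nonneg _
  have h1 := (norm_tr_fst_le hA u).trans hu
  have h2 : ‖(tr A u).2‖ ≤ (1 + 2 * ‖du A‖) * W := (norm_tr_snd_le hA u).trans (by gcongr)
  have h3 := (norm_tr_fst_le hA u').trans hu'
  have h4 : ‖(tr A u').2‖ ≤ (1 + 2 * ‖du A‖) * W := (norm_tr_snd_le hA u').trans (by gcongr)
  constructor
  · have h5 := norm_add_le (cross (tr A u).1 (tr A u).2) (tr A u').2
    have h6 : ‖cross (tr A u).1 (tr A u).2‖ ≤ W * ((1 + 2 * ‖du A‖) * W) :=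
      (norm_cross_le _ _).trans (by gcongr)
    nlinarith
  · have : ‖(tr A u).1‖ ^ 2 ≤ W ^ 2 := by gcongr
    linarith

theorem learnSignal_le {A : DualQuat} (hA : ‖re A‖ = 1) {u u' : DualVec} {W : ℝ}
    (hu : ‖u‖ ≤ W) (hu' : ‖u'‖ ≤ W) (x : DualVec) :
    learnSignal x (tr A u) (tr A u') ≤
      3 * (W ^ 2 + W + 1) * (1 + 2 * ‖du A‖) * (‖x.1‖ + ‖x.2‖) := by
  obtain ⟨h1, h2⟩ := coeff_bound hA hu hu'
  have hW : 0 ≤ W := (norm_nonneg _).trans hu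
  have h3 : ‖(tr A u).1‖ ^ 2 + ‖(tr A u').1‖ + 1 ≤ (W ^ 2 + W + 1) * (1 + 2 * ‖du A‖) :=
    h2.trans (le_mul_of_one_le_right (by positivity) (by linarith [norm_nonneg (du A)]))
  calc learnSignal x (tr A u) (tr A u')
      ≤ (W ^ 2 + W + 1) * (1 + 2 * ‖du A‖) * (3 * ‖x.2‖)
        + (W ^ 2 + W + 1) * (1 + 2 * ‖du A‖) * (3 * ‖x.1‖) := by
        unfold learnSignal
        gcongr
        · exact (norm_nonneg _).trans (norm_le_l1 _)
        · exact l1_le _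
        · exact (norm_nonneg _).trans (norm_le_l1 _)
        · exact l1_le _
    _ = _ := by ring

/-! ### The energy of the tracking error -/

/-- Kinetic energy of the velocity error plus `kp ‖δQ - ς‖²`. -/
def energy (m : ℝ) (J : Matrix (Fin 3) (Fin 3) ℝ) (kp ς : ℝ) (A : DualQuat) (x : DualVec) : ℝ :=
  1 / 2 * inner ℝ x.1 (inertiaCLM J x.1) + m / 2 * ‖x.2‖ ^ 2
    + kp * (‖re A - ς • 1‖ ^ 2 + ‖du A‖ ^ 2)

theorem exists_energy_bounds {m : ℝ} (hm : 0 < m) {J : Matrix (Fin 3) (Fin 3) ℝ} (hJ : J.PosDef)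
    {kp : ℝ} (hkp : 0 < kp) : ∃ c > 0, ∃ C > 0, ∀ ς A x,
      c * (‖x.1‖ ^ 2 + ‖x.2‖ ^ 2 + ‖re A - ς • 1‖ ^ 2 + ‖du A‖ ^ 2) ≤ energy m J kp ς A x ∧
      energy m J kp ς A x ≤ C * (‖x.1‖ ^ 2 + ‖x.2‖ ^ 2 + ‖re A - ς • 1‖ ^ 2 + ‖du A‖ ^ 2) := by
  obtain ⟨c, hc, hcJ⟩ := exists_inner_inertiaCLM_ge hJ
  have hJ0 : 0 ≤ ‖inertiaCLM J‖ := norm_nonneg _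
  refine ⟨min (c / 2) (min (m / 2) kp), by positivity, ‖inertiaCLM J‖ + m + kp, by positivity,
    fun ς A x => ⟨?_, ?_⟩⟩
  · have h1 : min (c / 2) (min (m / 2) kp) ≤ c / 2 := min_le_left _ _
    have h2 : min (c / 2) (min (m / 2) kp) ≤ m / 2 := (min_le_right _ _).trans (min_le_left _ _)
    have h3 : min (c / 2) (min (m / 2) kp) ≤ kp := (min_le_right _ _).trans (min_le_right _ _)
    have e1 := mul_le_mul_of_nonneg_right h1 (sq_nonneg ‖x.1‖)
    have e2 := mul_le_mul_of_nonneg_right h2 (sq_nonneg ‖x.2‖)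
    have e3 := mul_le_mul_of_nonneg_right h3 (sq_nonneg ‖re A - ς • 1‖)
    have e4 := mul_le_mul_of_nonneg_right h3 (sq_nonneg ‖du A‖)
    have := hcJ x.1
    unfold energy
    linarith
  · have h1 : inner ℝ x.1 (inertiaCLM J x.1) ≤ ‖inertiaCLM J‖ * ‖x.1‖ ^ 2 := by
      refine (real_inner_le_norm _ _).trans ?_
      have := mul_le_mul_of_nonneg_left ((inertiaCLM J).le_opNorm x.1) (norm_nonneg x.1)
      linarith
    unfold energy
    have e1 : 0 ≤ (‖inertiaCLM J‖ + m + kp) * ‖x.1‖ ^ 2 - 1 / 2 * (‖inertiaCLM J‖ * ‖x.1‖ ^ 2) := by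
      have : 0 ≤ (‖inertiaCLM J‖ / 2 + m + kp) * ‖x.1‖ ^ 2 := by positivity
      linarith
    have e2 : 0 ≤ (‖inertiaCLM J‖ + m / 2 + kp) * ‖x.2‖ ^ 2 := by positivity
    have e3 : 0 ≤ (‖inertiaCLM J‖ + m) * (‖re A - ς • 1‖ ^ 2 + ‖du A‖ ^ 2) := by positivity
    linarith

/-- Multiplication by a pure vector is skew, so a is orthogonal to a ∘ aug(x) and only the term with
ς survives. The same cancellation for b gives `inner_du_rate`. -/
theorem inner_re_rate (ς : ℝ) (a : ℍ[ℝ]) (x : E3) :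
    2 * inner ℝ (a - ς • 1) ((1 / 2 : ℝ) • (a * aug x)) = ς * inner ℝ (red a) x := by
  rw [Quaternion.inner_def, inner_vector]
  simp [red]
  ring

theorem inner_du_rate (a b : ℍ[ℝ]) (x y : E3) :
    2 * inner ℝ b ((1 / 2 : ℝ) • (a * aug y + b * aug x)) = inner ℝ (red (star a * b)) y := by
  rw [Quaternion.inner_def, inner_vector]
  simp [red]
  ring

theorem hasDerivWithinAt_re {A : ℝ → DualQuat} {x : DualVec} {S : Set ℝ} {t : ℝ}
    (hA : HasDerivWithinAt A ((1 / 2 : ℝ) • (A t * dualAug x)) S t) :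
    HasDerivWithinAt (fun τ => re (A τ)) ((1 / 2 : ℝ) • (re (A t) * aug x.1)) S t := by
  refine (reCLM.hasFDerivAt.comp_hasDerivWithinAt t hA).congr_deriv ?_
  change re _ = _
  simp

theorem hasDerivWithinAt_du {A : ℝ → DualQuat} {x : DualVec} {S : Set ℝ} {t : ℝ}
    (hA : HasDerivWithinAt A ((1 / 2 : ℝ) • (A t * dualAug x)) S t) :
    HasDerivWithinAt (fun τ => du (A τ))
      ((1 / 2 : ℝ) • (re (A t) * aug x.2 + du (A t) * aug x.1)) S t := by
  refine (duCLM.hasFDerivAt.comp_hasDerivWithinAt t hA).congr_deriv ?_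
  change du _ = _
  simp

theorem hasDerivWithinAt_potential {A : ℝ → DualQuat} {x : DualVec} {S : Set ℝ} {t : ℝ} (ς : ℝ)
    (hA : HasDerivWithinAt A ((1 / 2 : ℝ) • (A t * dualAug x)) S t) :
    HasDerivWithinAt (fun τ => ‖re (A τ) - ς • 1‖ ^ 2 + ‖du (A τ)‖ ^ 2)
      (ς * inner ℝ (red (re (A t))) x.1 + inner ℝ (red (star (re (A t)) * du (A t))) x.2) S t := by
  refine (((hasDerivWithinAt_re hA).sub_const (ς • 1)).norm_sq.add
    (hasDerivWithinAt_du hA).norm_sq).congr_deriv ?_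
  rw [inner_re_rate, inner_du_rate]

/-- The rate of change of the kinetic energy of the velocity error `x`, where `y + x` is the
velocity and `F` the total force: the gyroscopic terms that are quadratic in `x` cancel. -/
theorem kinetic_rate {m : ℝ} {J : Matrix (Fin 3) (Fin 3) ℝ} (hJ : J.PosDef) {x y z α F : DualVec}
    (h : inertia m J α = -dualCross (x + y) (inertia m J (x + y)) + F) :
    inner ℝ x.1 (inertiaCLM J (α - (z + dualCross y x)).1)
      + m * inner ℝ x.2 (α - (z + dualCross y x)).2 =
    crs x F - inner ℝ x.1 (cross y.1 (inertiaCLM J y.1) + inertiaCLM J z.1)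
      - m * inner ℝ x.2 (cross y.1 y.2 + z.2) := by
  rw [inertia_eq, inertia_eq] at h
  have h1 : m • α.2 = -cross (x.1 + y.1) (m • (x.2 + y.2)) + F.1 := congrArg Prod.fst h
  have h2 : inertiaCLM J α.1 = -(cross (x.1 + y.1) (inertiaCLM J (x.1 + y.1))
      + cross (x.2 + y.2) (m • (x.2 + y.2))) + F.2 := congrArg Prod.snd h
  have e1 : m * inner ℝ x.2 (α - (z + dualCross y x)).2 =
      inner ℝ x.2 (m • α.2) - m * inner ℝ x.2 (z.2 + (cross y.1 x.2 + cross y.2 x.1)) := by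
    rw [inner_smul_right, ← mul_sub, ← inner_sub_right]
    rfl
  -- Symmetry moves J from the cross product onto x. Afterwards J occurs only in Jx, Jy, Jz, and the
  -- identity holds with arbitrary vectors p, q, r in their place.
  have e2 : inner ℝ x.1 (inertiaCLM J (α - (z + dualCross y x)).1) =
      inner ℝ x.1 (inertiaCLM J α.1) - inner ℝ x.1 (inertiaCLM J z.1)
        - inner ℝ (inertiaCLM J x.1) (cross y.1 x.1) := by
    have : (α - (z + dualCross y x)).1 = α.1 - z.1 - cross y.1 x.1 := sub_add_eq_sub_sub _ _ _
    rw [this, map_sub, map_sub, inner_sub_right, inner_sub_right, inner_inertiaCLM_comm hJ _ (cross _ _)]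
  rw [e1, e2, h1, h2, map_add]
  generalize inertiaCLM J x.1 = p
  generalize inertiaCLM J y.1 = q
  generalize inertiaCLM J z.1 = r
  simp only [crs, inner_vector, cross_apply]
  simp
  ring

theorem crs_control {σ x : DualVec} (hσ : IsSgnSelection σ x) (kp kd θ : ℝ) (A : DualQuat)
    (u u' D : DualVec) :
    crs x (control kp kd θ σ A x u u' + D) =
      -(θ * learnSignal x (tr A u) (tr A u')) - kd * (‖x.1‖ ^ 2 + ‖x.2‖ ^ 2)
        - kp * inner ℝ (red (re A)) x.1 - kp * inner ℝ (red (star (re A) * du A)) x.2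
        + inner ℝ x.1 D.2 + inner ℝ x.2 D.1 := by
  rw [← crs_funcOfSgn hσ]
  simp only [control, crs, exch, re_conj, Prod.fst_add, Prod.snd_add, Prod.fst_sub, Prod.snd_sub,
    Prod.fst_neg, Prod.snd_neg, Prod.smul_fst, Prod.smul_snd, inner_add_right, inner_sub_right,
    inner_neg_right, inner_smul_right, inner_zero_right, real_inner_self_eq_norm_sq]
  rw [real_inner_comm x.1 (red (re A)), real_inner_comm x.2 (red (star (re A) * du A))]
  ring

/-- Dissipation inequality: the energy decreases whenever the estimate `θ` exceeds the threshold. -/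
theorem energy_rate_le {m : ℝ} (hm : 0 < m) {J : Matrix (Fin 3) (Fin 3) ℝ} (hJ : J.PosDef)
    {kp kd θ ς Bd Bs : ℝ} (hkp : 0 < kp) (hkd : 0 < kd) (hς : ς = 1 ∨ ς = -1)
    {A : DualQuat} (hA : ‖re A‖ = 1) {σ x u u' α : DualVec} {d s : E3} (hσ : IsSgnSelection σ x)
    (hd : ‖d‖ ≤ Bd) (hs : ‖s‖ ≤ Bs)
    (h : inertia m J α = -dualCross (x + tr A u) (inertia m J (x + tr A u))
      + (control kp kd θ σ A x u u' + (d, s))) :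
    inner ℝ x.1 (inertiaCLM J (α - (tr A u' + dualCross (tr A u) x)).1)
      + m * inner ℝ x.2 (α - (tr A u' + dualCross (tr A u) x)).2
      + kp * (ς * inner ℝ (red (re A)) x.1 + inner ℝ (red (star (re A) * du A)) x.2) ≤
    (m + ‖inertiaCLM J‖ + Bd + Bs + 2 * kp - θ) * learnSignal x (tr A u) (tr A u') := by
  rw [kinetic_rate hJ h, crs_control hσ]
  set y := tr A u
  set z := tr A u'
  have hJ0 : 0 ≤ ‖inertiaCLM J‖ := norm_nonneg _
  have hBd : 0 ≤ Bd := (norm_nonneg _).trans hd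
  have hBs : 0 ≤ Bs := (norm_nonneg _).trans hs
  set jn := ‖inertiaCLM J‖ with hjn
  have hkin : -inner ℝ x.1 (cross y.1 (inertiaCLM J y.1) + inertiaCLM J z.1) ≤
      ‖x.1‖ * (jn * (‖y.1‖ ^ 2 + ‖z.1‖)) := by
    rw [← inner_neg_right]
    refine (real_inner_le_norm _ _).trans (mul_le_mul_of_nonneg_left ?_ (norm_nonneg _))
    rw [norm_neg]
    have h1 := norm_add_le (cross y.1 (inertiaCLM J y.1)) (inertiaCLM J z.1)
    have h2 := norm_cross_le y.1 (inertiaCLM J y.1)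
    have h3 := mul_le_mul_of_nonneg_left ((inertiaCLM J).le_opNorm y.1) (norm_nonneg y.1)
    have h4 := (inertiaCLM J).le_opNorm z.1
    rw [← hjn] at h3 h4
    linarith
  have htr : -(m * inner ℝ x.2 (cross y.1 y.2 + z.2)) ≤ ‖x.2‖ * (m * ‖cross y.1 y.2 + z.2‖) := by
    have h1 := real_inner_le_norm x.2 (-(cross y.1 y.2 + z.2))
    rw [inner_neg_right, norm_neg] at h1
    have h2 := mul_le_mul_of_nonneg_left h1 hm.le
    linarith
  have hs' : inner ℝ x.1 s ≤ ‖x.1‖ * Bs :=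
    (real_inner_le_norm _ _).trans (mul_le_mul_of_nonneg_left hs (norm_nonneg _))
  have hd' : inner ℝ x.2 d ≤ ‖x.2‖ * Bd :=
    (real_inner_le_norm _ _).trans (mul_le_mul_of_nonneg_left hd (norm_nonneg _))
  -- For ς = 1 the attitude feedback cancels the potential rate. For ς = -1 it pushes towards the
  -- opposite sign, and the leftover is absorbed by the 2 kp in the threshold.
  have hpot : kp * (ς * inner ℝ (red (re A)) x.1) - kp * inner ℝ (red (re A)) x.1 ≤
      2 * kp * ‖x.1‖ := by
    have h1 : |inner ℝ (red (re A)) x.1| ≤ ‖x.1‖ := by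
      refine (abs_real_inner_le_norm _ _).trans ?_
      have := mul_le_mul_of_nonneg_right ((norm_red_le (re A)).trans hA.le) (norm_nonneg x.1)
      linarith
    have h2 := mul_le_mul_of_nonneg_left (neg_le_of_abs_le h1) hkp.le
    have h3 : 0 ≤ kp * ‖x.1‖ := by positivity
    rcases hς with rfl | rfl <;> linarith
  have hdiss : 0 ≤ kd * (‖x.1‖ ^ 2 + ‖x.2‖ ^ 2) := by positivity
  have hlow : (‖cross y.1 y.2 + z.2‖ + 1) * ‖x.2‖ + (‖y.1‖ ^ 2 + ‖z.1‖ + 1) * ‖x.1‖ ≤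
      learnSignal x y z := by
    unfold learnSignal
    gcongr
    · exact norm_le_l1 _
    · exact norm_le_l1 _
  have hfin := mul_le_mul_of_nonneg_left hlow
    (show 0 ≤ m + jn + Bd + Bs + 2 * kp by positivity)
  have r1 : 0 ≤ ((jn + Bd + Bs + 2 * kp) * ‖cross y.1 y.2 + z.2‖ + (m + jn + Bs + 2 * kp))
      * ‖x.2‖ := by positivity
  have r2 : 0 ≤ ((m + Bd + Bs + 2 * kp) * (‖y.1‖ ^ 2 + ‖z.1‖) + (m + jn + Bd)) * ‖x.1‖ := by
    positivity
  linarith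

/-! ### Analysis of one closed-loop trajectory -/

/-- `A` and `x` are the pose and velocity errors of a closed-loop trajectory with velocity `ω` and
estimate `θ`, where `u` is the desired velocity and `u'` its derivative; the disturbances are bounded
by `Bd` and `Bs`, and the trajectory starts at the pose error `ς = ±1` with zero velocity error. -/
structure IsErrorTrajectory (m : ℝ) (J : Matrix (Fin 3) (Fin 3) ℝ) (T kp kd W Bd Bs ς : ℝ)
    (u u' : ℝ → DualVec) (θ : ℝ → ℝ) (A : ℝ → DualQuat) (x ω : ℝ → DualVec) : Prop where
  desired : ∀ t ∈ Icc 0 T, HasDerivWithinAt u (u' t) (Icc 0 T) t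
  norm_desired : ∀ t ∈ Icc 0 T, ‖u t‖ ≤ W
  norm_desired_deriv : ∀ t ∈ Icc 0 T, ‖u' t‖ ≤ W
  kinematics : ∀ t ∈ Icc 0 T,
    HasDerivWithinAt A ((1 / 2 : ℝ) • (A t * dualAug (x t))) (Icc 0 T) t
  norm_re : ∀ t ∈ Icc 0 T, ‖re (A t)‖ = 1
  velocity : ∀ t, x t = ω t - tr (A t) (u t)
  absolutelyContinuous : AbsolutelyContinuousOnInterval ω 0 T
  dynamics : ∀ᵐ t ∂(volume.restrict (Icc 0 T)), ∃ (α σ : DualVec) (d s : E3),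
    HasDerivAt ω α t ∧ IsSgnSelection σ (x t) ∧ ‖d‖ ≤ Bd ∧ ‖s‖ ≤ Bs ∧
      inertia m J α = -dualCross (ω t) (inertia m J (ω t))
        + (control kp kd (θ t) σ (A t) (x t) (u t) (u' t) + (d, s))
  sign : ς = 1 ∨ ς = -1
  init_pose : A 0 = ς • (1 : DualQuat)
  init_velocity : x 0 = 0

theorem norm_dualCross_le (x y : DualVec) : ‖dualCross x y‖ ≤ 2 * (‖x‖ * ‖y‖) := by
  have hx1 := norm_fst_le x
  have hx2 := norm_snd_le x
  have hy1 := norm_fst_le y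
  have hy2 := norm_snd_le y
  have hxy : 0 ≤ ‖x‖ * ‖y‖ := by positivity
  have h : ∀ p q : E3, ‖p‖ ≤ ‖x‖ → ‖q‖ ≤ ‖y‖ → ‖cross p q‖ ≤ ‖x‖ * ‖y‖ := fun p q hp hq =>
    (norm_cross_le p q).trans (by gcongr)
  refine max_le ?_ ?_
  · exact (h _ _ hx1 hy1).trans (by linarith)
  · refine (norm_add_le _ _).trans ?_
    have h1 := h _ _ hx1 hy2
    have h2 := h _ _ hx2 hy1
    linarith

theorem hasDerivAt_kinetic {m : ℝ} {J : Matrix (Fin 3) (Fin 3) ℝ} (hJ : J.PosDef)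
    {x : ℝ → DualVec} {x' : DualVec} {t : ℝ} (hx : HasDerivAt x x' t) :
    HasDerivAt (fun τ => 1 / 2 * inner ℝ (x τ).1 (inertiaCLM J (x τ).1) + m / 2 * ‖(x τ).2‖ ^ 2)
      (inner ℝ (x t).1 (inertiaCLM J x'.1) + m * inner ℝ (x t).2 x'.2) t := by
  have h1 : HasDerivAt (fun τ => (x τ).1) x'.1 t :=
    (ContinuousLinearMap.fst ℝ E3 E3).hasFDerivAt.comp_hasDerivAt t hx
  have h2 : HasDerivAt (fun τ => (x τ).2) x'.2 t :=
    (ContinuousLinearMap.snd ℝ E3 E3).hasFDerivAt.comp_hasDerivAt t hx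
  have h3 : HasDerivAt (fun τ => inertiaCLM J (x τ).1) (inertiaCLM J x'.1) t :=
    (inertiaCLM J).hasFDerivAt.comp_hasDerivAt t h1
  refine (((h1.inner ℝ h3).const_mul (1 / 2)).add (h2.norm_sq.const_mul (m / 2))).congr_deriv ?_
  rw [inner_inertiaCLM_comm hJ x'.1, real_inner_comm (x t).1 (inertiaCLM J x'.1)]
  ring

namespace IsErrorTrajectory

variable {m : ℝ} {J : Matrix (Fin 3) (Fin 3) ℝ} {T kp kd W Bd Bs ς : ℝ}
  {u u' : ℝ → DualVec} {θ : ℝ → ℝ} {A : ℝ → DualQuat} {x ω : ℝ → DualVec}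

theorem continuousOn_re (H : IsErrorTrajectory m J T kp kd W Bd Bs ς u u' θ A x ω) :
    ContinuousOn (fun t => re (A t)) (Icc 0 T) := fun t ht =>
  (hasDerivWithinAt_re (H.kinematics t ht)).continuousWithinAt

theorem continuousOn_du (H : IsErrorTrajectory m J T kp kd W Bd Bs ς u u' θ A x ω) :
    ContinuousOn (fun t => du (A t)) (Icc 0 T) := fun t ht =>
  (hasDerivWithinAt_du (H.kinematics t ht)).continuousWithinAt

theorem hasDerivWithinAt_tr_desired (H : IsErrorTrajectory m J T kp kd W Bd Bs ς u u' θ A x ω) :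
    ∀ t ∈ Icc 0 T, HasDerivWithinAt (fun τ => tr (A τ) (u τ))
      (tr (A t) (u' t) + dualCross (tr (A t) (u t)) (x t)) (Icc 0 T) t := fun t ht =>
  hasDerivWithinAt_tr (H.kinematics t ht) (H.desired t ht)

theorem continuousOn_velocity (hT : 0 ≤ T)
    (H : IsErrorTrajectory m J T kp kd W Bd Bs ς u u' θ A x ω) : ContinuousOn x (Icc 0 T) := by
  have h1 := H.absolutelyContinuous.continuousOn
  rw [uIcc_of_le hT] at h1
  have h2 := h1.sub fun t ht => (H.hasDerivWithinAt_tr_desired t ht).continuousWithinAt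
  exact h2.congr fun t _ => H.velocity t

/-- ω is absolutely continuous by assumption and tr(u) is Lipschitz, having a bounded derivative.
The constants may depend on the trajectory, since only regularity is at stake. -/
theorem absolutelyContinuous_velocity (hT : 0 ≤ T)
    (H : IsErrorTrajectory m J T kp kd W Bd Bs ς u u' θ A x ω) :
    AbsolutelyContinuousOnInterval x 0 T := by
  obtain ⟨Mx, hMx⟩ := isCompact_Icc.exists_bound_of_continuousOn (H.continuousOn_velocity hT)
  obtain ⟨My, hMy⟩ := isCompact_Icc.exists_bound_of_continuousOn
    (fun t ht => (H.hasDerivWithinAt_tr_desired t ht).continuousWithinAt :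
      ContinuousOn (fun τ => tr (A τ) (u τ)) (Icc 0 T))
  obtain ⟨Mb, hMb⟩ := isCompact_Icc.exists_bound_of_continuousOn H.continuousOn_du
  have hy : AbsolutelyContinuousOnInterval (fun τ => tr (A τ) (u τ)) 0 T := by
    refine absolutelyContinuous_of_hasDerivWithinAt (C := (1 + 2 * Mb) * W + 2 * (My * Mx)) hT
      H.hasDerivWithinAt_tr_desired fun t ht => ?_
    have hW := H.norm_desired_deriv t ht
    have hW0 : 0 ≤ W := (norm_nonneg _).trans hW
    have hb := hMb t ht
    have hb0 := norm_nonneg (du (A t))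
    refine (norm_add_le _ _).trans (add_le_add (max_le ?_ ?_) ?_)
    · refine (norm_tr_fst_le (H.norm_re t ht) _).trans (hW.trans ?_)
      exact le_mul_of_one_le_left hW0 (by linarith)
    · refine (norm_tr_snd_le (H.norm_re t ht) _).trans ?_
      exact mul_le_mul (by linarith) hW (norm_nonneg _) (by linarith)
    · refine (norm_dualCross_le _ _).trans ?_
      have h1 := hMx t ht
      have h2 := hMy t ht
      have h3 := (norm_nonneg _).trans h2
      gcongr
  have hx : x = fun t => ω t - tr (A t) (u t) := funext H.velocity
  rw [hx]
  exact H.absolutelyContinuous.sub hy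

theorem absolutelyContinuous_potential (hT : 0 ≤ T)
    (H : IsErrorTrajectory m J T kp kd W Bd Bs ς u u' θ A x ω) :
    AbsolutelyContinuousOnInterval (fun t => ‖re (A t) - ς • 1‖ ^ 2 + ‖du (A t)‖ ^ 2) 0 T := by
  have hx := H.continuousOn_velocity hT
  have hred : Continuous red := redCLM.continuous
  have hc : ContinuousOn (fun t => ς * inner ℝ (red (re (A t))) (x t).1
      + inner ℝ (red (star (re (A t)) * du (A t))) (x t).2) (Icc 0 T) := by
    refine (continuousOn_const.mul ((hred.comp_continuousOn H.continuousOn_re).inner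
      hx.fst)).add (ContinuousOn.inner (hred.comp_continuousOn ?_) hx.snd)
    exact (continuous_star.comp_continuousOn H.continuousOn_re).mul H.continuousOn_du
  obtain ⟨M, hM⟩ := isCompact_Icc.exists_bound_of_continuousOn hc
  exact absolutelyContinuous_of_hasDerivWithinAt hT
    (fun t ht => hasDerivWithinAt_potential ς (H.kinematics t ht)) hM

theorem absolutelyContinuous_energy (hT : 0 ≤ T)
    (H : IsErrorTrajectory m J T kp kd W Bd Bs ς u u' θ A x ω) :
    AbsolutelyContinuousOnInterval (fun t => energy m J kp ς (A t) (x t)) 0 T := by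
  have hx := H.absolutelyContinuous_velocity hT
  have h1 : ∀ i, AbsolutelyContinuousOnInterval (fun t => (x t).1 i) 0 T := fun i =>
    absolutelyContinuous_clm_comp
      ((EuclideanSpace.proj i : E3 →L[ℝ] ℝ).comp (ContinuousLinearMap.fst ℝ E3 E3)) hx
  have h2 : ∀ i, AbsolutelyContinuousOnInterval (fun t => (x t).2 i) 0 T := fun i =>
    absolutelyContinuous_clm_comp
      ((EuclideanSpace.proj i : E3 →L[ℝ] ℝ).comp (ContinuousLinearMap.snd ℝ E3 E3)) hx
  have h3 : ∀ i, AbsolutelyContinuousOnInterval (fun t => inertiaCLM J (x t).1 i) 0 T := fun i =>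
    absolutelyContinuous_clm_comp ((EuclideanSpace.proj i : E3 →L[ℝ] ℝ).comp
      ((inertiaCLM J).comp (ContinuousLinearMap.fst ℝ E3 E3))) hx
  -- In coordinates the kinetic energy is a sum of products of scalar absolutely continuous
  -- functions.
  simp only [energy, inner_vector, norm_sq_vector, sq ((x _).2 _)]
  exact ((((((h1 0).mul (h3 0)).add ((h1 1).mul (h3 1))).add ((h1 2).mul (h3 2))).const_mul
    (1 / 2)).add (((((h2 0).mul (h2 0)).add ((h2 1).mul (h2 1))).add
    ((h2 2).mul (h2 2))).const_mul (m / 2))).add ((H.absolutelyContinuous_potential hT).const_mul kp)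

theorem energy_rate (hm : 0 < m) (hJ : J.PosDef) (hkp : 0 < kp) (hkd : 0 < kd)
    (H : IsErrorTrajectory m J T kp kd W Bd Bs ς u u' θ A x ω) :
    ∀ᵐ t ∂(volume.restrict (Icc 0 T)), ∃ v,
      HasDerivAt (fun t => energy m J kp ς (A t) (x t)) v t ∧
      v ≤ (m + ‖inertiaCLM J‖ + Bd + Bs + 2 * kp - θ t)
        * learnSignal (x t) (tr (A t) (u t)) (tr (A t) (u' t)) := by
  -- Discarding the endpoints turns derivatives within [0, T] into two-sided ones.
  have hne : ∀ r : ℝ, ∀ᵐ t ∂(volume.restrict (Icc 0 T)), t ≠ r := fun r =>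
    ae_restrict_of_ae (by simp [ae_iff])
  filter_upwards [H.dynamics, hne 0, hne T, ae_restrict_mem measurableSet_Icc] with t h h0 hT ht
  obtain ⟨α, σ, d, s, hω, hσ, hd, hs, hdyn⟩ := h
  have hnhds : Icc 0 T ∈ nhds t :=
    Icc_mem_nhds (lt_of_le_of_ne ht.1 (Ne.symm h0)) (lt_of_le_of_ne ht.2 hT)
  have hx : HasDerivAt x (α - (tr (A t) (u' t) + dualCross (tr (A t) (u t)) (x t))) t := by
    have := hω.sub ((H.hasDerivWithinAt_tr_desired t ht).hasDerivAt hnhds)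
    rwa [show ω - (fun τ => tr (A τ) (u τ)) = x from (funext H.velocity).symm] at this
  refine ⟨_, (hasDerivAt_kinetic hJ hx).add (((hasDerivWithinAt_potential ς
    (H.kinematics t ht)).hasDerivAt hnhds).const_mul kp), ?_⟩
  have hωx : ω t = x t + tr (A t) (u t) := by rw [H.velocity t, sub_add_cancel]
  rw [hωx] at hdyn
  exact energy_rate_le hm hJ hkp hkd H.sign (H.norm_re t ht) hσ hd hs hdyn

theorem energy_init (H : IsErrorTrajectory m J T kp kd W Bd Bs ς u u' θ A x ω) :
    energy m J kp ς (A 0) (x 0) = 0 := by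
  simp [energy, H.init_pose, H.init_velocity]

/-- The pose error starts exactly at ς and moves at a speed proportional to the velocity error. This
lets a learning law that sees only velocities control the pose. -/
theorem poseErr_le_integral (hT : 0 ≤ T)
    (H : IsErrorTrajectory m J T kp kd W Bd Bs ς u u' θ A x ω) {D : ℝ}
    (hD : ∀ t ∈ Icc 0 T, ‖du (A t)‖ ≤ D) {t : ℝ} (ht : t ∈ Icc 0 T) :
    ‖re (A t) - ς • 1‖ ≤ 1 * ∫ τ in (0)..t, (‖(x τ).1‖ + ‖(x τ).2‖) ∧
      ‖du (A t)‖ ≤ (1 + D) * ∫ τ in (0)..t, (‖(x τ).1‖ + ‖(x τ).2‖) := by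
  have hx := H.continuousOn_velocity hT
  have he : ContinuousOn (fun τ => ‖(x τ).1‖ + ‖(x τ).2‖) (Icc 0 T) := hx.fst.norm.add hx.snd.norm
  have haug : Continuous aug := augCLM.continuous
  have ha1 := haug.comp_continuousOn hx.fst
  have ha2 := haug.comp_continuousOn hx.snd
  constructor
  · have h := norm_sub_le_integral (C := 1) ht
      (fun t ht => hasDerivWithinAt_re (H.kinematics t ht))
      ((H.continuousOn_re.mul ha1).const_smul (1 / 2 : ℝ)) he (fun t ht => by
        rw [norm_smul, norm_mul, norm_aug, H.norm_re t ht, Real.norm_eq_abs,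
          abs_of_pos one_half_pos]
        linarith [norm_nonneg (x t).1, norm_nonneg (x t).2])
    simpa [H.init_pose] using h
  · have h := norm_sub_le_integral (C := 1 + D) ht
      (fun t ht => hasDerivWithinAt_du (H.kinematics t ht))
      (((H.continuousOn_re.mul ha2).add (H.continuousOn_du.mul ha1)).const_smul (1 / 2 : ℝ)) he
      (fun t ht => by
        have h1 := norm_add_le (re (A t) * aug (x t).2) (du (A t) * aug (x t).1)
        rw [norm_mul, norm_mul, norm_aug, norm_aug, H.norm_re t ht] at h1
        rw [norm_smul, Real.norm_eq_abs, abs_of_pos one_half_pos]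
        have h2 := mul_le_mul_of_nonneg_right (hD t ht) (norm_nonneg (x t).1)
        have h3 := norm_nonneg (x t).1
        have h4 := norm_nonneg (x t).2
        have h5 : 0 ≤ D := (norm_nonneg _).trans (hD t ht)
        have h6 := mul_nonneg h5 h3
        have h7 := mul_nonneg h5 h4
        linarith)
    simpa [H.init_pose] using h

end IsErrorTrajectory

/-- (p + q)² ≤ 2 K S² ≤ ((2K + 1) S)²; the crude factor avoids square roots. -/
theorem add_le_of_sq_add_sq_le {p q S K : ℝ} (hS : 0 ≤ S) (hK : 0 ≤ K)
    (h : p ^ 2 + q ^ 2 ≤ K * S ^ 2) : p + q ≤ (2 * K + 1) * S := by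
  refine le_of_sq_le_sq ?_ (by positivity)
  have h1 : 0 ≤ (4 * K ^ 2 + 2 * K + 1) * S ^ 2 := by positivity
  linarith [sq_nonneg (p - q)]

/-- Bounds of the errors along closed-loop trajectories, uniform over all trajectories. -/
theorem exists_trajectory_bounds {m : ℝ} (hm : 0 < m) {J : Matrix (Fin 3) (Fin 3) ℝ}
    (hJ : J.PosDef) {T kp kd : ℝ} (hT : 0 ≤ T) (hkp : 0 < kp) (hkd : 0 < kd) {W Bd Bs : ℝ}
    (hW : 0 ≤ W) (hBd : 0 ≤ Bd) (hBs : 0 ≤ Bs) :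
    ∃ D > 0, ∃ C > 0, ∃ Θ ≥ 0, ∀ ς u u' θ A x ω,
      IsErrorTrajectory m J T kp kd W Bd Bs ς u u' θ A x ω → (∀ t ∈ Icc 0 T, 0 ≤ θ t) →
      (∀ t ∈ Icc 0 T, ‖du (A t)‖ ≤ D ∧ ‖(x t).1‖ + ‖(x t).2‖ ≤ D) ∧
      (∀ t ∈ Icc 0 T,
        ‖re (A t) - ς • 1‖ + ‖du (A t)‖ ≤ C * ∫ τ in (0)..t, (‖(x τ).1‖ + ‖(x τ).2‖)) ∧
      ∀ a b, 0 ≤ a → a ≤ b → b ≤ T → (∀ t ∈ Ioc a b, Θ ≤ θ t) → ∀ t ∈ Ioc a b,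
        ‖(x t).1‖ + ‖(x t).2‖ ≤
          C * (‖(x a).1‖ + ‖(x a).2‖ + ∫ τ in (0)..a, (‖(x τ).1‖ + ‖(x τ).2‖)) := by
  obtain ⟨c, hc, C₀, hC₀, hcC⟩ := exists_energy_bounds hm hJ hkp
  have hJ0 : 0 ≤ ‖inertiaCLM J‖ := norm_nonneg _
  set Θ := m + ‖inertiaCLM J‖ + Bd + Bs + 2 * kp with hΘdef
  have hΘ : 0 ≤ Θ := by positivity
  -- The Grönwall rate: the middle factor comes from `learnSignal_le`, the last one from bounding (1
  -- + 2‖A_c‖) e by a multiple of V + 1.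
  set G := Θ * (3 * (W ^ 2 + W + 1)) * (4 * (1 + 1 / c)) with hG
  have hG0 : 0 ≤ G := by positivity
  -- Every error norm r satisfies r² ≤ exp(GT)/c, hence r ≤ exp(GT)/c + 1.
  set D := Real.exp (G * T) / c + 1 with hDdef
  have hE0 : 0 < Real.exp (G * T) / c := by positivity
  have hD : 0 < D := by positivity
  set L := 2 * C₀ / c + 1 with hLdef
  have hL : 1 ≤ L := by
    have : 0 ≤ 2 * C₀ / c := by positivity
    linarith
  refine ⟨2 * D, by positivity, L * (2 + 2 * D), by positivity, Θ, hΘ,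
    fun ς u u' θ A x ω H hθ => ?_⟩
  have hVac := H.absolutelyContinuous_energy hT
  have hrate := H.energy_rate hm hJ hkp hkd
  have hV : ∀ t ∈ Icc 0 T, energy m J kp ς (A t) (x t) + 1 ≤ Real.exp (G * T) := by
    intro t ht
    have h := le_exp_of_ae_hasDerivAt_le (C := G) hVac (by
      filter_upwards [hrate, ae_restrict_mem measurableSet_Icc] with r hr hrT
      obtain ⟨v, hv, hvle⟩ := hr
      refine ⟨v, hv, hvle.trans ?_⟩
      have hS0 : 0 ≤ learnSignal (x r) (tr (A r) (u r)) (tr (A r) (u' r)) :=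
        (by positivity : 0 ≤ ‖(x r).1‖ + ‖(x r).2‖).trans (norm_le_learnSignal _ _ _)
      have hS := learnSignal_le (H.norm_re r hrT) (H.norm_desired r hrT)
        (H.norm_desired_deriv r hrT) (x r)
      have hlow := (hcC ς (A r) (x r)).1
      set V := energy m J kp ς (A r) (x r)
      set p := ‖(x r).1‖
      set q := ‖(x r).2‖
      set b := ‖du (A r)‖
      have h1 : p ^ 2 + q ^ 2 + b ^ 2 ≤ V / c := by
        rw [le_div_iff₀ hc]
        have := mul_nonneg hc.le (sq_nonneg ‖re (A r) - ς • (1 : ℍ[ℝ])‖)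
        linarith
      have hV0 : 0 ≤ V := le_trans (by positivity) hlow
      have h2 : (1 + 2 * b) * (p + q) ≤ 4 * (1 + 1 / c) * (V + 1) := by
        have h3 : (1 + 2 * b) * (p + q) ≤ 4 * (1 + (p ^ 2 + q ^ 2 + b ^ 2)) := by
          nlinarith [sq_nonneg (1 + 2 * b - (p + q)), sq_nonneg (1 - 2 * b), sq_nonneg (p - q)]
        have h4 : 1 + V / c ≤ (1 + 1 / c) * (V + 1) := by
          have h5 : (1 + 1 / c) * (V + 1) = 1 + V / c + (V + 1 / c) := by ring
          have h6 : 0 ≤ V + 1 / c := by positivity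
          linarith
        linarith
      calc _ ≤ Θ * learnSignal (x r) (tr (A r) (u r)) (tr (A r) (u' r)) := by
            refine mul_le_mul_of_nonneg_right ?_ hS0
            linarith [hθ r hrT]
        _ ≤ Θ * (3 * (W ^ 2 + W + 1) * (1 + 2 * b) * (p + q)) := by gcongr
        _ = Θ * (3 * (W ^ 2 + W + 1)) * ((1 + 2 * b) * (p + q)) := by ring
        _ ≤ Θ * (3 * (W ^ 2 + W + 1)) * (4 * (1 + 1 / c) * (V + 1)) := by gcongr
        _ = G * (V + 1) := by rw [hG]; ring) ht
    rw [H.energy_init, zero_add, one_mul] at h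
    exact h.trans (Real.exp_le_exp.2 (by gcongr; exact ht.2))
  have hbd : ∀ t ∈ Icc 0 T, ‖du (A t)‖ ≤ D ∧ ‖(x t).1‖ ≤ D ∧ ‖(x t).2‖ ≤ D := by
    intro t ht
    have h1 := (hcC ς (A t) (x t)).1
    have h2 := hV t ht
    have hsum : ‖(x t).1‖ ^ 2 + ‖(x t).2‖ ^ 2 + ‖re (A t) - ς • 1‖ ^ 2 + ‖du (A t)‖ ^ 2 ≤
        Real.exp (G * T) / c := by
      rw [le_div_iff₀ hc]
      linarith
    have hle : ∀ r : ℝ, r ^ 2 ≤ Real.exp (G * T) / c → r ≤ D := by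
      intro r hr
      nlinarith [sq_nonneg (r - 1)]
    have e1 := sq_nonneg ‖(x t).1‖
    have e2 := sq_nonneg ‖(x t).2‖
    have e3 := sq_nonneg ‖re (A t) - ς • (1 : ℍ[ℝ])‖
    have e4 := sq_nonneg ‖du (A t)‖
    exact ⟨hle _ (by linarith), hle _ (by linarith), hle _ (by linarith)⟩
  have hpose := fun t (ht : t ∈ Icc 0 T) =>
    H.poseErr_le_integral hT (fun t ht => (hbd t ht).1) ht
  have hint : ∀ t ∈ Icc 0 T, 0 ≤ ∫ τ in (0)..t, (‖(x τ).1‖ + ‖(x τ).2‖) := fun t ht =>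
    intervalIntegral.integral_nonneg ht.1 fun τ _ => by positivity
  refine ⟨fun t ht => ⟨by linarith [(hbd t ht).1], by linarith [(hbd t ht).2.1, (hbd t ht).2.2]⟩,
    fun t ht => ?_, fun a b ha hab hb hΘab t ht => ?_⟩
  · obtain ⟨h1, h2⟩ := hpose t ht
    have h3 : (2 + 2 * D) * ∫ τ in (0)..t, (‖(x τ).1‖ + ‖(x τ).2‖) ≤
        L * (2 + 2 * D) * ∫ τ in (0)..t, (‖(x τ).1‖ + ‖(x τ).2‖) :=
      mul_le_mul_of_nonneg_right (le_mul_of_one_le_left (by positivity) hL) (hint t ht)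
    have h4 := mul_nonneg hD.le (hint t ht)
    linarith
  · have haT : a ∈ Icc 0 T := ⟨ha, hab.trans hb⟩
    -- Past the threshold the energy does not increase on (a, t]. Its value at a is then expressed
    -- through the velocity error at a and the integral bounding the pose error.
    have hdec := le_of_ae_hasDerivAt_nonpos hVac ha ht.1.le (ht.2.trans hb) (by
      filter_upwards [hrate] with r hr hrt
      obtain ⟨v, hv, hvle⟩ := hr
      refine ⟨v, hv, hvle.trans (mul_nonpos_of_nonpos_of_nonneg ?_ ?_)⟩
      · linarith [hΘab r ⟨hrt.1, hrt.2.trans ht.2⟩]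
      · exact (by positivity : 0 ≤ ‖(x r).1‖ + ‖(x r).2‖).trans (norm_le_learnSignal _ _ _))
    obtain ⟨h1, h2⟩ := hpose a haT
    have hI := hint a haT
    have hlow := (hcC ς (A t) (x t)).1
    have hup := (hcC ς (A a) (x a)).2
    set I := ∫ τ in (0)..a, (‖(x τ).1‖ + ‖(x τ).2‖)
    set p := ‖(x t).1‖
    set q := ‖(x t).2‖
    set pa := ‖(x a).1‖
    set qa := ‖(x a).2‖
    have hpa : 0 ≤ pa := norm_nonneg _
    have hqa : 0 ≤ qa := norm_nonneg _
    set ra := ‖re (A a) - ς • (1 : ℍ[ℝ])‖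
    set ba := ‖du (A a)‖
    have hra : 0 ≤ ra := norm_nonneg _
    have hba : 0 ≤ ba := norm_nonneg _
    have hsum : pa ^ 2 + qa ^ 2 + ra ^ 2 + ba ^ 2 ≤ ((2 + 2 * D) * (pa + qa + I)) ^ 2 := by
      have h3 : pa + qa + ra + ba ≤ (2 + 2 * D) * (pa + qa + I) := by
        have h4 : 0 ≤ (1 + 2 * D) * (pa + qa) := by positivity
        have h5 := mul_nonneg hD.le hI
        linarith
      have h6 : pa ^ 2 + qa ^ 2 + ra ^ 2 + ba ^ 2 ≤ (pa + qa + ra + ba) ^ 2 := by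
        have := mul_nonneg hpa hqa
        have := mul_nonneg hra hba
        have := mul_nonneg (add_nonneg hpa hqa) (add_nonneg hra hba)
        linarith
      exact h6.trans (pow_le_pow_left₀ (by positivity) h3 2)
    have hpq : p ^ 2 + q ^ 2 ≤ C₀ / c * ((2 + 2 * D) * (pa + qa + I)) ^ 2 := by
      rw [div_mul_eq_mul_div, le_div_iff₀ hc]
      have h3 := mul_le_mul_of_nonneg_left hsum hC₀.le
      have h4 : 0 ≤ c * (‖re (A t) - ς • (1 : ℍ[ℝ])‖ ^ 2 + ‖du (A t)‖ ^ 2) := by positivity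
      linarith
    have h3 := add_le_of_sq_add_sq_le (by positivity) (by positivity) hpq
    calc p + q ≤ (2 * (C₀ / c) + 1) * ((2 + 2 * D) * (pa + qa + I)) := h3
      _ = L * (2 + 2 * D) * (pa + qa + I) := by rw [hLdef]; ring

/-! ### From the error quaternion to the pose -/

/-- With a = Q_d* ∘ Q, the dual part of the pose error is ½ (a ∘ aug(P) - aug(P_d) ∘ a). Multiplying
by 2a* on the left gives the position error. -/
theorem norm_posErr_le {Qd Q : ℍ[ℝ]} (hQd : ‖Qd‖ = 1) (hQ : ‖Q‖ = 1) (Pd P : E3) :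
    ‖posErr Qd Pd Q P‖ ≤ 2 * ‖du (poseErr (pose Qd Pd) (pose Q P))‖ := by
  obtain ⟨a, ha⟩ : ∃ a, a = star Qd * Q := ⟨_, rfl⟩
  have ha1 : star a * a = 1 := by
    rw [Quaternion.star_mul_self, Quaternion.normSq_eq_norm_mul_self, ha, norm_mul, norm_star, hQd,
      hQ]
    simp
  have hdu : du (poseErr (pose Qd Pd) (pose Q P)) = (1 / 2 : ℝ) • (a * aug P - aug Pd * a) := by
    simp only [poseErr, pose, du_mul, re_conj, du_conj, re_mkDQ, du_mkDQ, ha, Quaternion.star_smul, star_mul,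
      star_aug, mul_smul_comm, smul_mul_assoc, neg_mul, smul_sub, smul_neg, mul_assoc]
    abel
  have hpos : posErr Qd Pd Q P
      = red ((2 : ℝ) • (star a * du (poseErr (pose Qd Pd) (pose Q P)))) := by
    rw [hdu, mul_smul_comm, smul_smul, mul_sub, ← mul_assoc, ← mul_assoc, ha1, one_mul]
    norm_num [posErr, red_sub, ha]
  rw [hpos]
  refine (norm_red_le _).trans ?_
  rw [norm_smul, norm_mul, norm_star, ha, norm_mul, norm_star, hQd, hQ]
  simp

theorem norm_red_le_norm_sub (a : ℍ[ℝ]) (ς : ℝ) : ‖red a‖ ≤ ‖a - ς • 1‖ := by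
  have : red a = red (a - ς • 1) := by
    ext i; fin_cases i <;> simp [red]
  rw [this]
  exact norm_red_le _

/-- If the pose errors of the poses `B k` approach the signs `ς k`, then `ς k • B k` converges to the
desired pose. -/
theorem tendsto_smul_pose {A : DualQuat} (hA : A * conj A = 1) {B : ℕ → DualQuat} {ς : ℕ → ℝ}
    (hς : ∀ k, ς k = 1 ∨ ς k = -1)
    (hre : Filter.Tendsto (fun k => ‖re (poseErr A (B k)) - ς k • 1‖) Filter.atTop (nhds 0))
    (hdu : Filter.Tendsto (fun k => ‖du (poseErr A (B k))‖) Filter.atTop (nhds 0)) :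
    Filter.Tendsto (fun k => ς k • B k) Filter.atTop (nhds A) := by
  -- Since A ∘ A* = 1, the pose is recovered as A times the pose error; it remains to see that ς δQ
  -- tends to 1, where ς² = 1 is used.
  have hB : ∀ k, ς k • B k = A * mkDQ (ς k • re (poseErr A (B k))) (ς k • du (poseErr A (B k))) := by
    intro k
    have h1 : mkDQ (ς k • re (poseErr A (B k))) (ς k • du (poseErr A (B k)))
        = ς k • poseErr A (B k) := by apply dualQuat_ext <;> simp
    rw [h1, dualQuat_mul_smul, poseErr, ← mul_assoc, hA, one_mul]
  have habs : ∀ k, |ς k| = 1 := fun k => by rcases hς k with h | h <;> simp [h]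
  have h1 : Filter.Tendsto (fun k => ς k • re (poseErr A (B k))) Filter.atTop (nhds 1) := by
    rw [tendsto_iff_norm_sub_tendsto_zero]
    refine hre.congr fun k => ?_
    have h2 : ς k • re (poseErr A (B k)) - 1 = ς k • (re (poseErr A (B k)) - ς k • 1) := by
      rw [smul_sub, smul_smul]
      rcases hς k with h | h <;> simp [h]
    rw [h2, norm_smul, Real.norm_eq_abs, habs, one_mul]
  have h2 : Filter.Tendsto (fun k => ς k • du (poseErr A (B k))) Filter.atTop (nhds 0) := by
    rw [tendsto_zero_iff_norm_tendsto_zero]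
    refine hdu.congr fun k => ?_
    rw [norm_smul, Real.norm_eq_abs, habs, one_mul]
  have h3 := (continuous_mkDQ.tendsto (1, 0)).comp (h1.prodMk_nhds h2)
  have h4 : mkDQ (1 : ℍ[ℝ]) 0 = 1 := by apply dualQuat_ext <;> simp
  have h5 := h3.const_mul A
  simp only [h4, mul_one] at h5
  exact h5.congr fun k => (hB k).symm

theorem norm_control_le {kp kd θ W D B : ℝ} (hkp : 0 < kp) (hkd : 0 < kd) {A : DualQuat}
    (hA : ‖re A‖ = 1) (hD : ‖du A‖ ≤ D) {x σ u u' : DualVec} (hσ : IsSgnSelection σ x)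
    (hx : ‖x.1‖ + ‖x.2‖ ≤ D) (hu : ‖u‖ ≤ W) (hu' : ‖u'‖ ≤ W) (hθ : |θ| ≤ B) :
    ‖(control kp kd θ σ A x u u').1‖ ≤
        B * ((W ^ 2 + W + 1) * (1 + 2 * D) * 3) + kd * D + kp * (1 + D) ∧
      ‖(control kp kd θ σ A x u u').2‖ ≤
        B * ((W ^ 2 + W + 1) * (1 + 2 * D) * 3) + kd * D + kp * (1 + D) := by
  obtain ⟨hσ1, hσ2⟩ := norm_sgnSelection_le hσ
  obtain ⟨hc1, hc2⟩ := coeff_bound hA hu hu'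
  have hW : 0 ≤ W := (norm_nonneg _).trans hu
  have hD0 : 0 ≤ D := (norm_nonneg _).trans hD
  have hB0 : 0 ≤ B := (abs_nonneg _).trans hθ
  set y := tr A u
  set z := tr A u'
  have hc1' : ‖cross y.1 y.2 + z.2‖ + 1 ≤ (W ^ 2 + W + 1) * (1 + 2 * D) :=
    hc1.trans (by gcongr)
  have hc2' : ‖y.1‖ ^ 2 + ‖z.1‖ + 1 ≤ (W ^ 2 + W + 1) * (1 + 2 * D) :=
    hc2.trans (le_mul_of_one_le_right (by positivity) (by linarith))
  have key : ∀ (c : ℝ) (s v w : E3), 0 ≤ c → c ≤ (W ^ 2 + W + 1) * (1 + 2 * D) → ‖s‖ ≤ 3 →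
      ‖v‖ ≤ D → ‖w‖ ≤ 1 + D → ‖-(θ • c • s) - kd • v - kp • w‖ ≤
        B * ((W ^ 2 + W + 1) * (1 + 2 * D) * 3) + kd * D + kp * (1 + D) := by
    intro c s v w hc0 hc hs hv hw
    refine (norm_sub_le _ _).trans (add_le_add ((norm_sub_le _ _).trans (add_le_add ?_ ?_)) ?_)
    · rw [norm_neg, norm_smul, norm_smul, Real.norm_eq_abs, Real.norm_eq_abs, abs_of_nonneg hc0]
      gcongr
    · rw [norm_smul, Real.norm_eq_abs, abs_of_pos hkd]
      gcongr
    · rw [norm_smul, Real.norm_eq_abs, abs_of_pos hkp]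
      gcongr
  have hx1 := norm_nonneg x.1
  have hx2 := norm_nonneg x.2
  constructor
  · have h := key _ σ.2 x.2 (red (star (re A) * du A)) (by positivity) hc1' hσ2 (by linarith) (by
      refine (norm_red_le _).trans ?_
      rw [norm_mul, norm_star, hA]
      linarith)
    simpa [control, funcOfSgn, exch] using h
  · have h := key _ σ.1 x.1 (red (re A)) (by positivity) hc2' hσ1 (by linarith)
      ((norm_red_le _).trans (by rw [hA]; linarith))
    simpa [control, funcOfSgn, exch] using h

end DualILC

end

/-! ### The closed-loop tracking theorem -/

theorem theorem2
    -- the rigid body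
    (m : ℝ) (hm : 0 < m) (J : Matrix (Fin 3) (Fin 3) ℝ) (hJ : J.PosDef)
    -- the segments `0 = h 0 < h 1 < ⋯ < h s = T`
    (T : ℝ) (s : ℕ) (hs : 1 ≤ s) (h : ℕ → ℝ) (h0 : h 0 = 0) (hT : h s = T)
    (hmono : ∀ j < s, h j < h (j + 1))
    -- the gains
    (kp kd kc kθ kl : ℝ) (hkp : 0 < kp) (hkd : 0 < kd) (hkc : 0 < kc) (hkθ : 0 < kθ) (hkl : 0 < kl)
    -- the desired trajectory: attitude, position, dual velocity and its derivative
    (Qd : ℝ → Quaternion ℝ) (Pd : ℝ → DualILC.E3) (ωd ωd' : ℝ → DualILC.DualVec)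
    (hQd : ∀ t ∈ Set.Icc 0 T, ‖Qd t‖ = 1)
    (hQd' : ∀ t ∈ Set.Icc 0 T, HasDerivWithinAt (fun τ => DualILC.pose (Qd τ) (Pd τ))
      ((1 / 2 : ℝ) • (DualILC.pose (Qd t) (Pd t) * DualILC.dualAug (ωd t))) (Set.Icc 0 T) t)
    (hωd' : ∀ t ∈ Set.Icc 0 T, HasDerivWithinAt ωd (ωd' t) (Set.Icc 0 T) t)
    (hωd'_bdd : ∃ B : ℝ, ∀ t ∈ Set.Icc 0 T, ‖ωd' t‖ ≤ B)
    -- the disturbance force and torque, bounded uniformly in the iteration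
    (d τd : ℕ → ℝ → DualILC.E3) (βd βs : ℝ → ℝ)
    (hβd : ∃ B : ℝ, ∀ t ∈ Set.Icc 0 T, βd t ≤ B) (hβs : ∃ B : ℝ, ∀ t ∈ Set.Icc 0 T, βs t ≤ B)
    (hd : ∀ k, ∀ t ∈ Set.Icc 0 T, ‖d k t‖ ≤ βd t)
    (hτd : ∀ k, ∀ t ∈ Set.Icc 0 T, ‖τd k t‖ ≤ βs t)
    -- attitude, position and dual velocity in iteration `k`
    (Q : ℕ → ℝ → Quaternion ℝ) (P : ℕ → ℝ → DualILC.E3) (ω : ℕ → ℝ → DualILC.DualVec)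
    (hQ : ∀ k, ∀ t ∈ Set.Icc 0 T, ‖Q k t‖ = 1)
    -- the errors
    (δQ : ℕ → ℝ → DualILC.DualQuat) (δω : ℕ → ℝ → DualILC.DualVec)
    (hδQ : ∀ k t, δQ k t =
      DualILC.poseErr (DualILC.pose (Qd t) (Pd t)) (DualILC.pose (Q k t) (P k t)))
    (hδω : ∀ k t, δω k t = DualILC.velErr (δQ k t) (ωd t) (ω k t))
    -- the value of the (set-valued) sign of the velocity error, and the control input
    (θhat : ℕ → ℝ → ℝ) (σ f : ℕ → ℝ → DualILC.DualVec)
    (hσ : ∀ k, ∀ t ∈ Set.Icc 0 T, DualILC.IsSgnSelection (σ k t) (δω k t))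
    (hf : ∀ k, ∀ t ∈ Set.Icc 0 T, f k t =
      DualILC.control kp kd (θhat k t) (σ k t) (δQ k t) (δω k t) (ωd t) (ωd' t))
    -- kinematics
    (hkin : ∀ k, ∀ t ∈ Set.Icc 0 T, HasDerivWithinAt (fun τ => DualILC.pose (Q k τ) (P k τ))
      ((1 / 2 : ℝ) • (DualILC.pose (Q k t) (P k t) * DualILC.dualAug (ω k t))) (Set.Icc 0 T) t)
    -- dynamics
    (hac : ∀ k, AbsolutelyContinuousOnInterval (ω k) 0 T)
    (hdyn : ∀ k, ∀ᵐ t ∂(MeasureTheory.volume.restrict (Set.Icc 0 T)),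
      ∃ a : DualILC.DualVec, HasDerivAt (ω k) a t ∧
        DualILC.inertia m J a =
          -DualILC.dualCross (ω k t) (DualILC.inertia m J (ω k t)) + f k t + (d k t, τd k t))
    -- the initial conditions `δQ k 0 = ±1 + ε 0`, `δω k 0 = 0 + ε 0`
    (sg : ℕ → ℝ) (hsg : ∀ k, sg k = 1 ∨ sg k = -1)
    (hinitQ : ∀ k, δQ k 0 = sg k • (1 : DualILC.DualQuat))
    (hinitω : ∀ k, δω k 0 = 0)
    -- the saturated iterative updating law
    (hθ0 : ∀ t ∈ Set.Icc 0 T, θhat 0 t = 0)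
    (hθ : ∀ k, ∀ t ∈ Set.Icc 0 T, θhat (k + 1) t - DualILC.proj s h kc (θhat k) t =
      min kl (kθ * DualILC.crs (δω (k + 1) t)
        (DualILC.func (δω (k + 1) t) (DualILC.tr (δQ (k + 1) t) (ωd t))
          (DualILC.tr (δQ (k + 1) t) (ωd' t))))) :
    -- perfect position-attitude tracking
    (∀ t ∈ Set.Icc 0 T,
      Filter.Tendsto (fun k => ‖DualILC.posErr (Qd t) (Pd t) (Q k t) (P k t)‖)
        Filter.atTop (nhds 0) ∧
      Filter.Tendsto (fun k => ‖DualILC.attErr (Qd t) (Q k t)‖) Filter.atTop (nhds 0) ∧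
      Filter.Tendsto (fun k => sg k • DualILC.pose (Q k t) (P k t))
        Filter.atTop (nhds (DualILC.pose (Qd t) (Pd t)))) ∧
    -- boundedness of inputs, errors and estimates, uniform in time and iteration
    (∃ B : ℝ, ∀ k, ∀ t ∈ Set.Icc 0 T,
      ‖(f k t).1‖ ≤ B ∧ ‖(f k t).2‖ ≤ B ∧
      ‖DualILC.re (δQ k t)‖ ≤ B ∧ ‖DualILC.du (δQ k t)‖ ≤ B ∧
      ‖(δω k t).1‖ ≤ B ∧ ‖(δω k t).2‖ ≤ B ∧ |θhat k t| ≤ B) := by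
  open DualILC Set MeasureTheory in
  have hT0 : 0 ≤ T := by
    rw [← hT, ← h0]
    exact breakpoint_le hmono (Nat.zero_le s) le_rfl
  have h0T : (0 : ℝ) ∈ Icc 0 T := ⟨le_rfl, hT0⟩
  -- The desired velocity is differentiable, hence bounded on the compact interval. Its derivative
  -- may be discontinuous, so its bound is taken from the hypotheses.
  obtain ⟨W₁, hW₁⟩ := isCompact_Icc.exists_bound_of_continuousOn
    (fun t ht => (hωd' t ht).continuousWithinAt : ContinuousOn ωd (Icc 0 T))
  obtain ⟨W₂, hW₂⟩ := hωd'_bdd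
  obtain ⟨Bd, hBd⟩ := hβd
  obtain ⟨Bs, hBs⟩ := hβs
  have hBd0 : 0 ≤ Bd := (norm_nonneg _).trans ((hd 0 0 h0T).trans (hBd 0 h0T))
  have hBs0 : 0 ≤ Bs := (norm_nonneg _).trans ((hτd 0 0 h0T).trans (hBs 0 h0T))
  obtain ⟨W, hW0, hW, hW'⟩ : ∃ W, 0 ≤ W ∧ (∀ t ∈ Icc 0 T, ‖ωd t‖ ≤ W) ∧
      ∀ t ∈ Icc 0 T, ‖ωd' t‖ ≤ W :=
    ⟨max W₁ W₂, ((norm_nonneg _).trans (hW₁ 0 h0T)).trans (le_max_left _ _),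
      fun t ht => (hW₁ t ht).trans (le_max_left _ _),
      fun t ht => (hW₂ t ht).trans (le_max_right _ _)⟩
  have hre1 : ∀ k, ∀ t ∈ Icc 0 T, ‖re (δQ k t)‖ = 1 := fun k t ht => by
    simp [hδQ, poseErr, pose, hQd t ht, hQ k t ht]
  have H : ∀ k, IsErrorTrajectory m J T kp kd W Bd Bs (sg k) ωd ωd' (θhat k) (δQ k) (δω k) (ω k) := by
    intro k
    refine ⟨hωd', hW, hW', fun t ht => ?_, hre1 k, hδω k, hac k, ?_, hsg k, hinitQ k, hinitω k⟩
    · have := hasDerivWithinAt_poseErr (hQd' t ht) (hkin k t ht) (conj_mul_pose (hQd t ht) _)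
        (pose_mul_conj (hQ k t ht) _)
      rw [hδω k t, hδQ k t]
      exact this.congr (fun τ _ => hδQ k τ) (hδQ k t)
    · filter_upwards [hdyn k, ae_restrict_mem measurableSet_Icc] with t ha ht
      obtain ⟨α, hα, hαeq⟩ := ha
      refine ⟨α, σ k t, d k t, τd k t, hα, hσ k t ht, (hd k t ht).trans (hBd t ht),
        (hτd k t ht).trans (hBs t ht), ?_⟩
      rw [hαeq, hf k t ht, add_assoc]
  obtain ⟨D, hD, C, hC, Θ, hΘ, hbounds⟩ :=
    exists_trajectory_bounds hm hJ hT0 hkp hkd hW0 hBd0 hBs0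
  have hθ' : ∀ k, ∀ t ∈ Icc 0 T, θhat (k + 1) t - proj s h kc (θhat k) t = min kl (kθ *
      learnSignal (δω (k + 1) t) (tr (δQ (k + 1) t) (ωd t)) (tr (δQ (k + 1) t) (ωd' t))) := by
    intro k t ht
    rw [hθ k t ht, func, crs_funcOfSgn (isSgnSelection_dualSgn _)]
  have hθnn : ∀ k, ∀ t ∈ Icc 0 T, 0 ≤ θhat k t := fun k t ht =>
    (hθ0 t ht).symm.le.trans (estimate_monotone (g := fun k t =>
      learnSignal (δω k t) (tr (δQ k t) (ωd t)) (tr (δQ k t) (ωd' t))) hkl hkθ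
      (fun k t _ => (by positivity : 0 ≤ ‖(δω k t).1‖ + ‖(δω k t).2‖).trans
        (norm_le_learnSignal _ _ _)) hθ' ht (Nat.zero_le k))
  have hb := fun k => hbounds _ _ _ _ _ _ _ (H k) (hθnn k)
  have hec : ∀ k, ContinuousOn (fun t => ‖(δω k t).1‖ + ‖(δω k t).2‖) (Icc 0 T) := fun k =>
    ((H k).continuousOn_velocity hT0).fst.norm.add ((H k).continuousOn_velocity hT0).snd.norm
  -- One constant serves both the decay estimate and the bound of the learning signal by the
  -- velocity error.
  obtain ⟨B, hB⟩ := learning_bounded (C := max C (3 * (W ^ 2 + W + 1) * (1 + 2 * D))) (D := D)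
    (g := fun k t => learnSignal (δω k t) (tr (δQ k t) (ωd t)) (tr (δQ k t) (ωd' t)))
    (e := fun k t => ‖(δω k t).1‖ + ‖(δω k t).2‖)
    hs hT h0 hmono hkc hkl hkθ hΘ (hC.le.trans (le_max_left _ _)) hD hθ0 hθ' hec
    (fun k t _ => by positivity) (fun k t ht => ((hb k).1 t ht).2) (fun k => by simp [hinitω])
    (fun k t _ => norm_le_learnSignal _ _ _)
    (fun k t ht => by
      refine (learnSignal_le (hre1 k t ht) (hW t ht) (hW' t ht) _).trans ?_
      have h1 := ((hb k).1 t ht).1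
      refine mul_le_mul_of_nonneg_right (le_trans ?_ (le_max_right _ _)) (by positivity)
      gcongr)
    (fun k a b ha hab hbT hΘab t ht => ((hb k).2.2 a b ha hab hbT hΘab t ht).trans
      (mul_le_mul_of_nonneg_right (le_max_left _ _) (add_nonneg (by positivity)
        (intervalIntegral.integral_nonneg ha fun τ _ => by positivity))))
  constructor
  · intro t ht
    have hsub : Icc 0 t ⊆ Icc 0 T := Icc_subset_Icc le_rfl ht.2
    have hsum := sum_integral_le ht.1 (fun k => (hec k).mono hsub) fun τ hτ => (hB τ (hsub hτ)).1
    -- The pose errors are summable over k, being bounded by the integrals of the velocity errors,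
    -- whose sums are at most B t.
    have hlim : Filter.Tendsto (fun k => ‖re (δQ k t) - sg k • 1‖ + ‖du (δQ k t)‖)
        Filter.atTop (nhds 0) := by
      refine (summable_of_sum_range_le (c := C * (B * t)) (fun k => by positivity)
        fun n => ?_).tendsto_atTop_zero
      refine (Finset.sum_le_sum fun k _ => (hb k).2.1 t ht).trans ?_
      rw [← Finset.mul_sum]
      exact mul_le_mul_of_nonneg_left (hsum n) hC.le
    have hlimre : Filter.Tendsto (fun k => ‖re (δQ k t) - sg k • 1‖) Filter.atTop (nhds 0) :=
      squeeze_zero (fun k => norm_nonneg _) (fun k => le_add_of_nonneg_right (norm_nonneg _)) hlim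
    have hlimdu : Filter.Tendsto (fun k => ‖du (δQ k t)‖) Filter.atTop (nhds 0) :=
      squeeze_zero (fun k => norm_nonneg _) (fun k => le_add_of_nonneg_left (norm_nonneg _)) hlim
    refine ⟨?_, ?_, ?_⟩
    · have h2 := hlimdu.const_mul 2
      rw [mul_zero] at h2
      refine squeeze_zero (fun k => norm_nonneg _) (fun k => ?_) h2
      rw [hδQ]
      exact norm_posErr_le (hQd t ht) (hQ k t ht) _ _
    · refine squeeze_zero (fun k => norm_nonneg _) (fun k => ?_) hlimre
      have h2 : re (δQ k t) = star (Qd t) * Q k t := by simp [hδQ, poseErr, pose]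
      rw [h2]
      exact norm_red_le_norm_sub _ _
    · simp only [hδQ] at hlimre hlimdu
      exact tendsto_smul_pose (pose_mul_conj (hQd t ht) _) hsg hlimre hlimdu
  · have hB0 : 0 ≤ B := (abs_nonneg _).trans ((hB 0 h0T).2 0)
    set M := B * ((W ^ 2 + W + 1) * (1 + 2 * D) * 3) + kd * D + kp * (1 + D)
    have hM0 : 0 ≤ M := by positivity
    refine ⟨M + 1 + D + B, fun k t ht => ?_⟩
    obtain ⟨hdu, hx⟩ := (hb k).1 t ht
    obtain ⟨hf1, hf2⟩ := norm_control_le hkp hkd (hre1 k t ht) hdu (hσ k t ht) hx (hW t ht)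
      (hW' t ht) ((hB t ht).2 k)
    rw [← hf k t ht] at hf1 hf2
    have hx1 := norm_nonneg (δω k t).1
    have hx2 := norm_nonneg (δω k t).2
    have hθB := (hB t ht).2 k
    have hr := hre1 k t ht
    exact ⟨by linarith, by linarith, by linarith, by linarith, by linarith, by linarith,
      by linarith⟩
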